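/- For a finite set $C$ of positive integers let $\langle C\rangle\subseteq\mathbb N$ be the semigroup (containing $0$) generated by $C$; it is a numerical semigroup if $\gcd(C)=1$, and it is minimally generated by $C$ if no proper subset of $C$ generates it. Let $k$ be a field. Let $A=\{a_1,\dots,a_p\}$, $B=\{b_1,\dots,b_q\}$ and $C$ be finite sets of positive integers that minimally generate numerical semigroups $\langle A\rangle$, $\langle B\rangle$, $\langle C\rangle$, and suppose that $\langle C\rangle$ is obtained by gluing $\langle A\rangle$ and $\langle B\rangle$, i.e. $C=k_1A\sqcup k_2B$ (disjoint union) for relatively prime positive integers $k_1\in\langle B\rangle\setminus B$ and $k_2\in\langle A\rangle\setminus A$. Put $R_A=k[x_1,\dots,x_p]$, $R_B=k[y_1,\dots,y_q]$, $R=k[x_1,\dots,x_p,y_1,\dots,y_q]$, graded by $\deg x_i=a_i$ in $R_A$, $\deg y_j=b_j$ in $R_B$, and $\deg x_i=k_1a_i$, $\deg y_j=k_2b_j$ in $R$. Let $k[A],k[B],k[C]\subseteq k[t]$ be the images of the $k$-algebra homomorphisms $R_A,R_B,R\to k[t]$ that send each variable of degree $d$ to $t^{d}$, graded by $\deg t=1$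 and viewed as graded modules over $R_A$, $R_B$, $R$ through these maps, and let $I_A$, $I_B$ be the kernels of the first two maps. Choose non-negative integers $\alpha_i,\beta_j$ with $k_2=\sum_i\alpha_ia_i$ and $k_1=\sum_j\beta_jb_j$, and let $\rho=\prod_i x_i^{\alpha_i}-\prod_j y_j^{\beta_j}\in R$, which is homogeneous of degree $k_1k_2$. A minimal graded free resolution of a graded module $M$ over one of these polynomial rings $S$, with $\mathfrak m$ the ideal generated by the variables, is a complex $\cdots\to F_1\to F_0\to 0$ of graded free $S$-modules of finite rank with differentials $\partial_i$ homogeneous of degree $0$, which is exact in positive homological degrees, has a degree-$0$ surjection $F_0\to M$ with kernel $\partial_1(F_1)$, and satisfies $\partial_i(F_i)\subseteq\mathfrak mF_{i-1}$ for all $i\ge1$. Let $F_A$ and $F_B$ be minimal graded free resolutions of $k[A]$ over $R_A$ and of $k[B]$ over $R_B$. Let $F_A\otimes F_B$ denote the complex $(F_A\otimes_{R_A}R)\otimes_R(F_B\otimes_{R_B}R)$ of $R$-modules, graded so that $u\otimes v$ has degree $k_1\deg u+k_2\deg v$ for homogeneous $u\in F_A$, $v\in F_B$. Then: 1. $F_A\otimes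 F_B$ is a minimal graded free resolution of $R/(I_AR+I_BR)$ over $R$. 2. The mapping cone of the map $\rho:F_A\otimes F_B\to F_A\otimes F_B$ given by multiplication by $\rho$, with module $(F_A\otimes F_B)_{n-1}(-k_1k_2)\oplus(F_A\otimes F_B)_n$ in homological degree $n$, is a minimal graded free resolution of $k[C]$ over $R$. In particular $(I_AR+I_BR:\rho)=I_AR+I_BR$. -/

import Mathlib

open CategoryTheory MonoidalCategory

universe u

noncomputable section

/-! ### Numerical semigroups and gluings -/

/-- `C` is a set of positive integers with greatest common divisor `1` (so `⟨C⟩`, the submonoid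
`AddSubmonoid.closure C` of `ℕ`, is a numerical semigroup), and no proper subset of `C` generates
`⟨C⟩`. -/
structure MinimallyGeneratesNumericalSemigroup (C : Finset ℕ) : Prop where
  pos : ∀ c ∈ C, 0 < c
  gcd_eq_one : C.gcd id = 1
  minimal : ∀ D : Finset ℕ, D ⊂ C →
    AddSubmonoid.closure (D : Set ℕ) ≠ AddSubmonoid.closure (C : Set ℕ)

/-- The numerical semigroup `⟨C⟩`, with minimal generating set `C`, is obtained by gluing `⟨A⟩` and
`⟨B⟩`, through the decomposition `C = k₁ A ⊔ k₂ B`. -/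
structure IsGluing (C A B : Finset ℕ) (k₁ k₂ : ℕ) : Prop where
  minC : MinimallyGeneratesNumericalSemigroup C
  minA : MinimallyGeneratesNumericalSemigroup A
  minB : MinimallyGeneratesNumericalSemigroup B
  eq_union : C = A.image (k₁ * ·) ∪ B.image (k₂ * ·)
  disjoint : Disjoint (A.image (k₁ * ·)) (B.image (k₂ * ·))
  pos₁ : 0 < k₁
  pos₂ : 0 < k₂
  coprime : Nat.Coprime k₁ k₂
  mem₁ : k₁ ∈ AddSubmonoid.closure (B : Set ℕ)
  notMem₁ : k₁ ∉ B
  mem₂ : k₂ ∈ AddSubmonoid.closure (A : Set ℕ)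
  notMem₂ : k₂ ∉ A

/-! ### Semigroup rings -/

section SemigroupRing

variable (k : Type u) [Field k] {σ : Type} (c : σ → ℕ)

/-- The `k`-algebra map `k[x_i : i ∈ σ] → k[t]`, `x_i ↦ t ^ c_i`. -/
def semigroupMap : MvPolynomial σ k →ₐ[k] Polynomial k :=
  MvPolynomial.aeval fun i => Polynomial.X ^ c i

/-- The defining ideal: the kernel of `x_i ↦ t ^ c_i`. -/
def semigroupIdeal : Ideal (MvPolynomial σ k) :=
  RingHom.ker (semigroupMap k c)

/-- The semigroup ring `k[t ^ c_i : i ∈ σ] ⊆ k[t]`, the image of `x_i ↦ t ^ c_i`. -/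
abbrev semigroupRing : Subalgebra k (Polynomial k) :=
  (semigroupMap k c).range

/-- The semigroup ring is a module over the polynomial ring through `x_i ↦ t ^ c_i`. -/
instance semigroupRing.module : Module (MvPolynomial σ k) (semigroupRing k c) :=
  Module.compHom (semigroupRing k c) (semigroupMap k c).rangeRestrict.toRingHom

/-- The grading of the semigroup ring in which `t` has degree `1`: the elements of degree `d` are
those of the form `a t ^ d` (only `0` for `d < 0`). -/
def semigroupRing.grading (d : ℤ) : AddSubgroup (semigroupRing k c) where
  carrier := {f | ∀ n : ℕ, (f : Polynomial k).coeff n ≠ 0 → (n : ℤ) = d}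
  zero_mem' := by intro n hn; simp at hn
  add_mem' := by
    intro f g hf hg n hn
    by_contra h
    have hf' : (f : Polynomial k).coeff n = 0 := by
      by_contra h'
      exact h (hf n h')
    have hg' : (g : Polynomial k).coeff n = 0 := by
      by_contra h'
      exact h (hg n h')
    exact hn (by simp [hf', hg'])
  neg_mem' := by
    intro f hf n hn
    exact hf n (by simpa using hn)

end SemigroupRing

/-! ### Graded modules and minimal graded free resolutions

The polynomial ring `R = k[x_i : i ∈ σ]` is graded by weights `w : σ → ℤ` of the variables. A grading
of an `R`-module `M` is given by its homogeneous components `ℳ d ⊆ M`, `d : ℤ`. -/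

section Resolutions

variable {k : Type u} [Field k] {σ : Type}

/-- The grading of `R ⧸ J` induced by the weights `w`: the components are the images of those of
`R`. -/
def quotientGrading (w : σ → ℤ) (J : Ideal (MvPolynomial σ k)) (d : ℤ) :
    AddSubgroup (MvPolynomial σ k ⧸ J) :=
  (MvPolynomial.weightedHomogeneousSubmodule k w d).toAddSubgroup.map
    (Ideal.Quotient.mk J).toAddMonoidHom

/-- `M` with the grading `ℳ` is a graded free module of finite rank: it has a finite `R`-basis
`b` and degrees `e` such that `M = ⨁ R b_j` is `⨁ R(-e_j)` as a graded module, i.e. an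
element is homogeneous of degree `d` iff its `j`-th coordinate is homogeneous of degree
`d - e_j`, for all `j`. -/
def IsGradedFree (w : σ → ℤ) {M : Type u} [AddCommGroup M] [Module (MvPolynomial σ k) M]
    (ℳ : ℤ → AddSubgroup M) : Prop :=
  ∃ (n : ℕ) (b : Module.Basis (Fin n) (MvPolynomial σ k) M) (e : Fin n → ℤ),
    ∀ (d : ℤ) (x : M),
      x ∈ ℳ d ↔ ∀ j, MvPolynomial.IsWeightedHomogeneous w (b.repr x j) (d - e j)

/-- The chain complex `F : ⋯ → F₂ → F₁ → F₀ → 0` of `R`-modules, where `F_i` carries the grading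
`𝓕 i`, is a minimal graded free resolution of the module `M` with grading `ℳ`. -/
structure IsMinimalGradedFreeResolution (w : σ → ℤ)
    (F : ChainComplex (ModuleCat.{u} (MvPolynomial σ k)) ℕ)
    (𝓕 : ∀ i : ℕ, ℤ → AddSubgroup (F.X i))
    {M : Type u} [AddCommGroup M] [Module (MvPolynomial σ k) M] (ℳ : ℤ → AddSubgroup M) :
    Prop where
  /-- Each `F_i` is a graded free module of finite rank. -/
  free : ∀ i, IsGradedFree (k := k) w (𝓕 i)
  /-- The differentials are homogeneous of degree `0`. -/
  d_mem : ∀ (i j : ℕ) (d : ℤ), ∀ x ∈ 𝓕 i d, (F.d i j).hom x ∈ 𝓕 j d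
  /-- `F` is exact in positive homological degrees. -/
  exact : ∀ i, 0 < i → F.ExactAt i
  /-- There is an augmentation `F₀ → M`, homogeneous of degree `0`, such that
  `F₁ → F₀ → M → 0` is exact. -/
  augmentation : ∃ ε : F.X 0 →ₗ[MvPolynomial σ k] M,
    (∀ d, ∀ x ∈ 𝓕 0 d, ε x ∈ ℳ d) ∧ Function.Surjective ε ∧
      Function.Exact (F.d 1 0).hom ε
  /-- The differentials have image in `(x_i : i ∈ σ) F`. -/
  minimal : ∀ i, LinearMap.range (F.d (i + 1) i).hom ≤
    Ideal.span (Set.range (MvPolynomial.X : σ → MvPolynomial σ k)) •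
      (⊤ : Submodule (MvPolynomial σ k) (F.X i))

end Resolutions

/-! ### Extension of scalars, tensor products and mapping cones, with their gradings -/

section Constructions

variable {k : Type u} [Field k] {σ τ : Type}

/-- The complex `F ⊗_{k[σ]} k[τ]` of `k[τ]`-modules, for an inclusion `f : σ → τ` of variables. -/
def extendComplex (f : σ → τ) (F : ChainComplex (ModuleCat.{u} (MvPolynomial σ k)) ℕ) :
    ChainComplex (ModuleCat.{u} (MvPolynomial τ k)) ℕ :=
  ((ModuleCat.extendScalars.{u, u, u}
    (MvPolynomial.rename (R := k) f).toRingHom).mapHomologicalComplex (ComplexShape.down ℕ)).obj F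

open ChangeOfRings in
/-- The grading of `F ⊗_{k[σ]} k[τ]`, where `k[τ]` is graded by `w`, and where degrees in `F` are
multiplied by `m` (it is meant for the case that `f i` has `m` times the weight of `i`): the
component of degree `d` is generated by the `r ⊗ x` with `deg r + m deg x = d`. -/
def extendGrading (f : σ → τ) (w : τ → ℤ) (m : ℤ)
    (F : ChainComplex (ModuleCat.{u} (MvPolynomial σ k)) ℕ)
    (𝓕 : ∀ i : ℕ, ℤ → AddSubgroup (F.X i)) (i : ℕ) (d : ℤ) :
    AddSubgroup ((extendComplex f F).X i) :=
  AddSubgroup.closure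
    {z | ∃ (r : MvPolynomial τ k) (x : F.X i) (a b : ℤ),
      MvPolynomial.IsWeightedHomogeneous w r a ∧ x ∈ 𝓕 i b ∧ a + m * b = d ∧
      z = (r ⊗ₜ[MvPolynomial σ k, (MvPolynomial.rename (R := k) f).toRingHom] x)}

/-- The grading of the tensor product complex: the component of degree `d` of
`(K ⊗ L)_n = ⨁_{i + j = n} K_i ⊗ L_j` is generated by the `x ⊗ y` with
`deg x + deg y = d`. -/
def tensorGrading (K L : ChainComplex (ModuleCat.{u} (MvPolynomial τ k)) ℕ)
    (𝓚 : ∀ i : ℕ, ℤ → AddSubgroup (K.X i)) (𝓛 : ∀ i : ℕ, ℤ → AddSubgroup (L.X i))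
    (n : ℕ) (d : ℤ) : AddSubgroup ((HomologicalComplex.tensorObj K L).X n) :=
  AddSubgroup.closure
    {z | ∃ (i j : ℕ) (h : i + j = n) (x : K.X i) (y : L.X j) (a b : ℤ),
      x ∈ 𝓚 i a ∧ y ∈ 𝓛 j b ∧ a + b = d ∧
      z = (HomologicalComplex.ιTensorObj K L i j n h).hom (x ⊗ₜ[MvPolynomial τ k] y)}

/-- The grading of the mapping cone of a map `φ : K → L` that is homogeneous of degree `e`: in
homological degree `n` it is `K_{n-1}(-e) ⊕ L_n` (just `L_0` for `n = 0`). -/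
def coneGrading {K L : ChainComplex (ModuleCat.{u} (MvPolynomial τ k)) ℕ} (φ : K ⟶ L) (e : ℤ)
    (𝓚 : ∀ i : ℕ, ℤ → AddSubgroup (K.X i)) (𝓛 : ∀ i : ℕ, ℤ → AddSubgroup (L.X i))
    (n : ℕ) (d : ℤ) : AddSubgroup ((HomologicalComplex.homotopyCofiber φ).X n) :=
  AddSubgroup.closure
    ({z | ∃ (i : ℕ) (h : (ComplexShape.down ℕ).Rel n i), ∃ x ∈ 𝓚 i (d - e),
        z = (HomologicalComplex.homotopyCofiber.inlX φ i n h).hom x} ∪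
      {z | ∃ y ∈ 𝓛 n d, z = (HomologicalComplex.homotopyCofiber.inrX φ n).hom y})

end Constructions

/-! ### The objects attached to a gluing

The variables are indexed by the elements of `A` and `B`: `R_A = k[x_a : a ∈ A]`,
`R_B = k[y_b : b ∈ B]` and `R = k[x_a, y_b : a ∈ A, b ∈ B]`. -/

section Gluing

/-- The weights of the variables of `R`: `k₁ a` for `x_a` and `k₂ b` for `y_b`. By
`C = k₁ A ⊔ k₂ B`, these are the elements of `C`. -/
def gluingWeight (A B : Finset ℕ) (k₁ k₂ : ℕ) : A ⊕ B → ℕ :=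
  Sum.elim (fun a => k₁ * a) (fun b => k₂ * b)

variable (k : Type u) [Field k] (A B : Finset ℕ)

/-- The ideal `I_A R + I_B R`. -/
def gluingIdeal : Ideal (MvPolynomial (A ⊕ B) k) :=
  (semigroupIdeal k (fun a : A => (a : ℕ))).map (MvPolynomial.rename (R := k) Sum.inl) ⊔
    (semigroupIdeal k (fun b : B => (b : ℕ))).map (MvPolynomial.rename (R := k) Sum.inr)

variable {A B}

/-- The binomial `ρ = ∏ x_a ^ α_a - ∏ y_b ^ β_b`. -/
def gluingBinomial (α : A → ℕ) (β : B → ℕ) : MvPolynomial (A ⊕ B) k :=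
  ∏ a : A, MvPolynomial.X (Sum.inl a) ^ α a - ∏ b : B, MvPolynomial.X (Sum.inr b) ^ β b

variable {k}

/-- `F_A ⊗ F_B`, as a complex of `R`-modules. -/
def gluingTensor (FA : ChainComplex (ModuleCat.{u} (MvPolynomial A k)) ℕ)
    (FB : ChainComplex (ModuleCat.{u} (MvPolynomial B k)) ℕ) :
    ChainComplex (ModuleCat.{u} (MvPolynomial (A ⊕ B) k)) ℕ :=
  HomologicalComplex.tensorObj (extendComplex Sum.inl FA) (extendComplex Sum.inr FB)

/-- The grading of `F_A ⊗ F_B`. -/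
def gluingTensorGrading (k₁ k₂ : ℕ)
    (FA : ChainComplex (ModuleCat.{u} (MvPolynomial A k)) ℕ)
    (𝓐 : ∀ i : ℕ, ℤ → AddSubgroup (FA.X i))
    (FB : ChainComplex (ModuleCat.{u} (MvPolynomial B k)) ℕ)
    (𝓑 : ∀ i : ℕ, ℤ → AddSubgroup (FB.X i)) :
    ∀ i : ℕ, ℤ → AddSubgroup ((gluingTensor FA FB).X i) :=
  tensorGrading (extendComplex Sum.inl FA) (extendComplex Sum.inr FB)
    (extendGrading Sum.inl (fun v => (gluingWeight A B k₁ k₂ v : ℤ)) k₁ FA 𝓐)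
    (extendGrading Sum.inr (fun v => (gluingWeight A B k₁ k₂ v : ℤ)) k₂ FB 𝓑)

end Gluing

end

/-! Let `I = I_A R + I_B R`. It is the kernel of the map to `k[s,t]` with `x_a ↦ s ^ a`, `y_b ↦ t ^
b` (`gluingIdeal_eq_ker`), hence prime. The image of `ρ` is `s ^ k₂ - t ^ k₁ ≠ 0`, so `ρ` is a
nonzerodivisor modulo `I`, which gives the statement on the colon ideal. Coprimality of `k₁` and
`k₂` yields `I_C = I + (ρ)` (`semigroupIdeal_gluingWeight`): two monomials of equal degree in `R`
differ, modulo `I`, by trading powers of `∏ x_a ^ α_a` for equal powers of `∏ y_b ^ β_b`.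

For the resolution of `R / I`, the point is that `F_A` and `F_B` use disjoint variables. Tensoring
`R ⊗ k[A]` over `R` with `R ⊗ N`, for an `R_B`-module `N`, gives `k[A] ⊗_k N`, which is exact in `N`
since `k` is a field (`exact_lTensor_baseChange`). Thus `(R ⊗ k[A]) ⊗ F_B` is exact in positive
degrees, and replacing `R ⊗ k[A]` by its resolution preserves this (`tensorObj_exactAt`). In degree
`0`, right exactness identifies the cokernel with `R / I_A R ⊗ R / I_B R = R / I`.

The mapping cone of a nonzerodivisor `ρ` on a resolution of `M` resolves `M / ρ M`
(`cone_smul_exactAt`, `cone_smul_exact_augmentation`), and for `M = R / I` this is `R / I_C = k[C]`.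
Minimality passes to tensor products, and to the cone because `ρ` lies in the ideal of the
variables. Gradings are followed through explicit homogeneous bases (`isGradedFree_closure`). -/

section PolynomialPart

open MvPolynomial

lemma weight_natCast {σ : Type*} (c : σ → ℕ) (u : σ →₀ ℕ) :
    Finsupp.weight (fun i => (c i : ℤ)) u = (Finsupp.weight c u : ℕ) := by
  simp [Finsupp.weight_apply, Finsupp.sum]

/-- If a linear map sends the monomials to members of a linearly independent family, then its kernel
is contained in every ideal that contains the differences of any two monomials with the same
image. -/
lemma mem_of_forall_monomial_sub_mem {k : Type*} [Field k] {σ N V : Type*} [AddCommGroup V]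
    [Module k V] {e : N → V} (he : LinearIndependent k e) (g : (σ →₀ ℕ) → N)
    (φ : MvPolynomial σ k →ₗ[k] V) (hφ : ∀ u, φ (monomial u 1) = e (g u))
    (J : Ideal (MvPolynomial σ k))
    (hJ : ∀ u v, g u = g v → (monomial u 1 - monomial v 1 : MvPolynomial σ k) ∈ J)
    {f : MvPolynomial σ k} (hf : φ f = 0) : f ∈ J := by
  -- The formal version of `φ`: since the family `e` is independent, `Φ` has the same kernel.
  let Φ : MvPolynomial σ k →ₗ[k] (N →₀ k) :=
    (basisMonomials σ k).constr k fun u => Finsupp.single (g u) 1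
  have hΦ (u) : Φ (monomial u 1) = Finsupp.single (g u) 1 := by
    have := (basisMonomials σ k).constr_basis k (fun u => Finsupp.single (g u) (1 : k)) u
    simpa using this
  have h₁ : Finsupp.linearCombination k e ∘ₗ Φ = φ := by
    refine (basisMonomials σ k).ext fun u => ?_
    simp [hΦ, hφ]
  have h₂ : Φ f = 0 := by
    apply he
    rw [map_zero, ← hf, ← h₁]
    rfl
  -- `Function.invFun g n` picks some exponent over `n` (a junk value outside the range of `g`). By
  -- `hJ` the class of its monomial does not depend on the choice, so the quotient map factors as `ψ
  -- ∘ Φ`.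
  let ψ : (N →₀ k) →ₗ[k] (MvPolynomial σ k ⧸ J) :=
    Finsupp.linearCombination k fun n => Ideal.Quotient.mk J (monomial (Function.invFun g n) 1)
  have h₃ : ψ ∘ₗ Φ = (Ideal.Quotient.mkₐ k J).toLinearMap := by
    refine (basisMonomials σ k).ext fun u => ?_
    simp only [coe_basisMonomials, LinearMap.comp_apply, hΦ, ψ, Finsupp.linearCombination_single,
      one_smul, AlgHom.toLinearMap_apply, Ideal.Quotient.mkₐ_eq_mk]
    rw [Ideal.Quotient.eq]
    exact hJ _ _ (Function.invFun_eq ⟨u, rfl⟩)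
  rw [← Ideal.Quotient.eq_zero_iff_mem]
  have := LinearMap.congr_fun h₃ f
  simp only [LinearMap.comp_apply, h₂, map_zero] at this
  exact this.symm

/-! ### Toric ideal and grading of one semigroup ring -/

section SemigroupRing

variable {k : Type*} [Field k] {σ : Type} (c : σ → ℕ)

lemma semigroupMap_monomial (u : σ →₀ ℕ) (r : k) :
    semigroupMap k c (monomial u r) = Polynomial.monomial (Finsupp.weight c u) r := by
  rw [semigroupMap, aeval_monomial, Finsupp.weight_apply, Finsupp.prod, Finsupp.sum]
  simp_rw [← pow_mul, Finset.prod_pow_eq_pow_sum, smul_eq_mul]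
  rw [← Polynomial.C_mul_X_pow_eq_monomial]
  simp [mul_comm]

lemma monomial_sub_mem_semigroupIdeal {u v : σ →₀ ℕ}
    (h : Finsupp.weight c u = Finsupp.weight c v) :
    (monomial u 1 - monomial v 1 : MvPolynomial σ k) ∈ semigroupIdeal k c := by
  rw [semigroupIdeal, RingHom.mem_ker, map_sub, semigroupMap_monomial, semigroupMap_monomial, h,
    sub_self]

lemma semigroupIdeal_le (J : Ideal (MvPolynomial σ k))
    (hJ : ∀ u v, Finsupp.weight c u = Finsupp.weight c v →
      (monomial u 1 - monomial v 1 : MvPolynomial σ k) ∈ J) :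
    semigroupIdeal k c ≤ J := fun _ hf =>
  mem_of_forall_monomial_sub_mem (Polynomial.basisMonomials k).linearIndependent
    (Finsupp.weight c) (semigroupMap k c).toLinearMap (by simp [semigroupMap_monomial]) J hJ hf

lemma semigroupMap_coeff_of_isWeightedHomogeneous {p : MvPolynomial σ k} {d : ℤ}
    (hp : IsWeightedHomogeneous (fun i => (c i : ℤ)) p d) (n : ℕ)
    (hn : (semigroupMap k c p).coeff n ≠ 0) : (n : ℤ) = d := by
  by_contra h
  apply hn
  rw [p.as_sum, map_sum, Polynomial.finsetSum_coeff]
  refine Finset.sum_eq_zero fun u hu => ?_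
  rw [semigroupMap_monomial, Polynomial.coeff_monomial, if_neg]
  rintro rfl
  exact h (by rw [← weight_natCast]; exact hp (mem_support_iff.mp hu))

/-- Take the degree `d` component of any preimage: the map preserves degrees, so the other
components do not contribute to the coefficient of `t ^ d`. Homogeneous lifts are what makes the
augmentations to quotients of `R` homogeneous. -/
lemma exists_isWeightedHomogeneous_semigroupMap_eq {d : ℤ} {f : semigroupRing k c}
    (hf : f ∈ semigroupRing.grading k c d) :
    ∃ p : MvPolynomial σ k, IsWeightedHomogeneous (fun i => (c i : ℤ)) p d ∧
      semigroupMap k c p = f := by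
  obtain ⟨p, hp⟩ := f.2
  refine ⟨weightedHomogeneousComponent (fun i => (c i : ℤ)) d p,
    weightedHomogeneousComponent_isWeightedHomogeneous _ _, ?_⟩
  have hfd := fun n => hf n
  rw [← show semigroupMap k c p = f from hp] at hfd ⊢
  have hfin := weightedHomogeneousComponent_finsupp (w := fun i => (c i : ℤ)) p
  have hsum := sum_weightedHomogeneousComponent (fun i => (c i : ℤ)) p
  rw [finsum_eq_sum _ hfin] at hsum
  ext n
  by_cases hn : (n : ℤ) = d
  · conv_rhs => rw [← hsum]
    rw [map_sum, Polynomial.finsetSum_coeff, Finset.sum_eq_single d]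
    · intro e _ he
      by_contra h
      exact he ((semigroupMap_coeff_of_isWeightedHomogeneous c
        (weightedHomogeneousComponent_isWeightedHomogeneous _ _) n h).symm.trans hn)
    · intro hd
      have : weightedHomogeneousComponent (fun i => (c i : ℤ)) d p = 0 := by
        by_contra h
        exact hd ((Set.Finite.mem_toFinset (hs := hfin)).2 h)
      simp [this]
  · have h₁ : (semigroupMap k c p).coeff n = 0 := by
      by_contra h
      exact hn (hfd n h)
    rw [h₁]
    by_contra h
    exact hn (semigroupMap_coeff_of_isWeightedHomogeneous c
      (weightedHomogeneousComponent_isWeightedHomogeneous _ _) n h)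

end SemigroupRing

/-! ### The ideals `I_A R + I_B R` and `I_C`, and the binomial `ρ` -/

section Gluing

variable (k : Type*) [Field k] {A B : Finset ℕ}

/-- The map `x_a ↦ s ^ a`, `y_b ↦ t ^ b`. -/
noncomputable def gluingBigradedMap : MvPolynomial (A ⊕ B) k →ₐ[k] MvPolynomial Bool k :=
  aeval (Sum.elim (fun a => X false ^ (a : ℕ)) fun b => X true ^ (b : ℕ))

/-- The exponents of the `x`-part of a monomial of `R`. -/
noncomputable abbrev exponentL (u : A ⊕ B →₀ ℕ) : A →₀ ℕ :=
  u.comapDomain Sum.inl Sum.inl_injective.injOn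

noncomputable abbrev exponentR (u : A ⊕ B →₀ ℕ) : B →₀ ℕ :=
  u.comapDomain Sum.inr Sum.inr_injective.injOn

lemma eq_add_exponents (u : A ⊕ B →₀ ℕ) :
    u = (exponentL u).mapDomain Sum.inl + (exponentR u).mapDomain Sum.inr := by
  ext (a | b)
  · rw [Finsupp.add_apply, Finsupp.mapDomain_apply Sum.inl_injective,
      Finsupp.mapDomain_of_notMem_range _ _ (by simp)]
    simp
  · rw [Finsupp.add_apply, Finsupp.mapDomain_apply Sum.inr_injective,
      Finsupp.mapDomain_of_notMem_range _ _ (by simp)]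
    simp

lemma monomial_eq_rename_mul_rename (u : A ⊕ B →₀ ℕ) :
    (monomial u 1 : MvPolynomial (A ⊕ B) k) =
      rename Sum.inl (monomial (exponentL u) 1) * rename Sum.inr (monomial (exponentR u) 1) := by
  rw [rename_monomial, rename_monomial, monomial_mul, ← eq_add_exponents, one_mul]

lemma gluingBigradedMap_rename_inl (p : MvPolynomial A k) :
    gluingBigradedMap k (B := B) (rename Sum.inl p) =
      Polynomial.aeval (X false) (semigroupMap k (fun a : A => (a : ℕ)) p) := by
  have : (gluingBigradedMap k (B := B)).comp (rename (Sum.inl : A → A ⊕ B)) =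
      (Polynomial.aeval (X false)).comp (semigroupMap k (fun a : A => (a : ℕ))) := by
    ext a
    simp [gluingBigradedMap, semigroupMap]
  exact congr($this p)

lemma gluingBigradedMap_rename_inr (p : MvPolynomial B k) :
    gluingBigradedMap k (A := A) (rename Sum.inr p) =
      Polynomial.aeval (X true) (semigroupMap k (fun b : B => (b : ℕ)) p) := by
  have : (gluingBigradedMap k (A := A)).comp (rename (Sum.inr : B → A ⊕ B)) =
      (Polynomial.aeval (X true)).comp (semigroupMap k (fun b : B => (b : ℕ))) := by
    ext a
    simp [gluingBigradedMap, semigroupMap]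
  exact congr($this p)

variable {k} in
lemma rename_inl_mem_gluingIdeal {p : MvPolynomial A k}
    (hp : p ∈ semigroupIdeal k (fun a : A => (a : ℕ))) :
    rename Sum.inl p ∈ gluingIdeal k A B :=
  Ideal.mem_sup_left (Ideal.mem_map_of_mem _ hp)

variable {k} in
lemma rename_inr_mem_gluingIdeal {p : MvPolynomial B k}
    (hp : p ∈ semigroupIdeal k (fun b : B => (b : ℕ))) :
    rename Sum.inr p ∈ gluingIdeal k A B :=
  Ideal.mem_sup_right (Ideal.mem_map_of_mem _ hp)

/-- The ideal `I_A R + I_B R` is the kernel of `x_a ↦ s ^ a`, `y_b ↦ t ^ b`. -/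
lemma gluingIdeal_eq_ker : gluingIdeal k A B = RingHom.ker (gluingBigradedMap k) := by
  apply le_antisymm
  · refine sup_le (Ideal.map_le_iff_le_comap.2 fun p hp => ?_)
      (Ideal.map_le_iff_le_comap.2 fun p hp => ?_)
    · rw [semigroupIdeal, RingHom.mem_ker] at hp
      rw [Ideal.mem_comap, RingHom.mem_ker, gluingBigradedMap_rename_inl, hp, map_zero]
    · rw [semigroupIdeal, RingHom.mem_ker] at hp
      rw [Ideal.mem_comap, RingHom.mem_ker, gluingBigradedMap_rename_inr, hp, map_zero]
  · intro f hf
    -- Each monomial of `R` maps to a monomial in `s` and `t`. If two have the same image, their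
    -- `x`-parts agree modulo `I_A` and their `y`-parts modulo `I_B`, hence so do the products.
    refine mem_of_forall_monomial_sub_mem (basisMonomials Bool k).linearIndependent
      (fun u => Finsupp.single false (Finsupp.weight (fun a : A => (a : ℕ)) (exponentL u)) +
        Finsupp.single true (Finsupp.weight (fun b : B => (b : ℕ)) (exponentR u)))
      (gluingBigradedMap k).toLinearMap (fun u => ?_) _ (fun u v h => ?_) hf
    · rw [AlgHom.toLinearMap_apply, monomial_eq_rename_mul_rename, map_mul,
        gluingBigradedMap_rename_inl, gluingBigradedMap_rename_inr, semigroupMap_monomial,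
        semigroupMap_monomial]
      simp [X_pow_eq_monomial, monomial_mul]
    · have h₁ := DFunLike.congr_fun h false
      have h₂ := DFunLike.congr_fun h true
      simp only [Finsupp.coe_add, Pi.add_apply, Finsupp.single_apply] at h₁ h₂
      simp only [if_true, reduceCtorEq, if_false, add_zero, zero_add] at h₁ h₂
      have e₁ := rename_inl_mem_gluingIdeal (B := B) (monomial_sub_mem_semigroupIdeal (k := k) _ h₁)
      have e₂ := rename_inr_mem_gluingIdeal (A := A) (monomial_sub_mem_semigroupIdeal (k := k) _ h₂)
      rw [map_sub] at e₁ e₂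
      rw [monomial_eq_rename_mul_rename, monomial_eq_rename_mul_rename k v]
      exact Ideal.mul_sub_mul_mem _ e₁ e₂

variable {k₁ k₂ : ℕ} (α : A → ℕ) (β : B → ℕ)

lemma gluingBinomial_eq : gluingBinomial k α β =
    rename Sum.inl (monomial (Finsupp.equivFunOnFinite.symm α) 1) -
      rename Sum.inr (monomial (Finsupp.equivFunOnFinite.symm β) 1) := by
  rw [gluingBinomial, monomial_eq, monomial_eq]
  simp [Finsupp.prod_fintype]

lemma weight_equivFunOnFinite_symm {A : Finset ℕ} (α : A → ℕ) :
    Finsupp.weight (fun a : A => (a : ℕ)) (Finsupp.equivFunOnFinite.symm α) =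
      ∑ a : A, α a * (a : ℕ) := by
  rw [Finsupp.weight_apply, Finsupp.sum_fintype _ _ (by simp)]
  simp

variable {α β}

/-- The image of `ρ` in `k[s,t]` is `s ^ k₂` minus a power of `t`. As `k₂ > 0`, these are distinct
monomials, so the coefficient of `s ^ k₂` is `1`. -/
lemma gluingBinomial_notMem_gluingIdeal (hα : ∑ a : A, α a * (a : ℕ) = k₂) (h₂ : 0 < k₂) :
    gluingBinomial k α β ∉ gluingIdeal k A B := by
  rw [gluingIdeal_eq_ker, RingHom.mem_ker, gluingBinomial_eq, map_sub,
    gluingBigradedMap_rename_inl, gluingBigradedMap_rename_inr, semigroupMap_monomial,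
    semigroupMap_monomial, weight_equivFunOnFinite_symm, weight_equivFunOnFinite_symm, hα]
  intro h
  have := congr(coeff (Finsupp.single false k₂) $h)
  simp [X_pow_eq_monomial, coeff_monomial, Finsupp.single_eq_single_iff, h₂.ne'] at this

/-- The quotient embeds in the domain `k[s,t]`. Primality turns `ρ ∉ I_A R + I_B R` into `ρ` being a
nonzerodivisor on the quotient. -/
instance gluingIdeal_isPrime : (gluingIdeal k A B).IsPrime := by
  rw [gluingIdeal_eq_ker]
  exact RingHom.ker_isPrime _

variable (k₁ k₂) in
lemma weight_gluingWeight (u : A ⊕ B →₀ ℕ) :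
    Finsupp.weight (gluingWeight A B k₁ k₂) u =
      k₁ * Finsupp.weight (fun a : A => (a : ℕ)) (exponentL u) +
        k₂ * Finsupp.weight (fun b : B => (b : ℕ)) (exponentR u) := by
  simp only [Finsupp.weight_apply]
  rw [Finsupp.sum_fintype _ _ (by simp), Finsupp.sum_fintype _ _ (by simp),
    Finsupp.sum_fintype _ _ (by simp), Fintype.sum_sum_type, Finset.mul_sum, Finset.mul_sum]
  simp [gluingWeight, mul_left_comm]

lemma semigroupMap_gluingWeight_rename_inl (p : MvPolynomial A k) :
    semigroupMap k (gluingWeight A B k₁ k₂) (rename Sum.inl p) =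
      Polynomial.aeval (Polynomial.X ^ k₁) (semigroupMap k (fun a : A => (a : ℕ)) p) := by
  have : (semigroupMap k (gluingWeight A B k₁ k₂)).comp (rename Sum.inl) =
      (Polynomial.aeval (Polynomial.X ^ k₁)).comp (semigroupMap k (fun a : A => (a : ℕ))) := by
    ext a
    simp [gluingWeight, semigroupMap, pow_mul]
  exact congr($this p)

lemma semigroupMap_gluingWeight_rename_inr (p : MvPolynomial B k) :
    semigroupMap k (gluingWeight A B k₁ k₂) (rename Sum.inr p) =
      Polynomial.aeval (Polynomial.X ^ k₂) (semigroupMap k (fun b : B => (b : ℕ)) p) := by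
  have : (semigroupMap k (gluingWeight A B k₁ k₂)).comp (rename Sum.inr) =
      (Polynomial.aeval (Polynomial.X ^ k₂)).comp (semigroupMap k (fun b : B => (b : ℕ))) := by
    ext a
    simp [gluingWeight, semigroupMap, pow_mul]
  exact congr($this p)

/-- The heart of the description of `I_C`. Equality of degrees says that `k₁` times the excess of
`u` in `A`-weight is `k₂` times the excess of `v` in `B`-weight, so by coprimality the excesses are
`k₂ * m` and `k₁ * m`. Modulo `I_A` the `x`-part of `u` is that of `v` times the `m`-th power of `∏
x_a ^ α_a`; modulo `I_B` the `y`-part of `v` is that of `u` times the `m`-th power of `∏ y_b ^ β_b`;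
and `ρ` identifies the two powers. -/
lemma monomial_sub_mem_of_le (hk : Nat.Coprime k₁ k₂) (h₂ : 0 < k₂)
    (hα : ∑ a : A, α a * (a : ℕ) = k₂) (hβ : ∑ b : B, β b * (b : ℕ) = k₁) {u v : A ⊕ B →₀ ℕ}
    (h : Finsupp.weight (gluingWeight A B k₁ k₂) u = Finsupp.weight (gluingWeight A B k₁ k₂) v)
    (hle : Finsupp.weight (fun a : A => (a : ℕ)) (exponentL v) ≤
      Finsupp.weight (fun a : A => (a : ℕ)) (exponentL u)) :
    (monomial u 1 - monomial v 1 : MvPolynomial (A ⊕ B) k) ∈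
      gluingIdeal k A B ⊔ Ideal.span {gluingBinomial k α β} := by
  rw [weight_gluingWeight, weight_gluingWeight] at h
  obtain ⟨c, hc⟩ := Nat.exists_eq_add_of_le hle
  rw [hc] at h
  have h' : k₁ * c + k₂ * Finsupp.weight (fun b : B => (b : ℕ)) (exponentR u) =
    k₂ * Finsupp.weight (fun b : B => (b : ℕ)) (exponentR v) := by linarith
  obtain ⟨m, rfl⟩ : k₂ ∣ c := by
    apply hk.symm.dvd_of_dvd_mul_left
    exact (Nat.dvd_add_left (dvd_mul_right _ _)).1 (h' ▸ dvd_mul_right _ _)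
  have hv : Finsupp.weight (fun b : B => (b : ℕ)) (exponentR v) =
      Finsupp.weight (fun b : B => (b : ℕ)) (exponentR u) + k₁ * m := by
    apply Nat.eq_of_mul_eq_mul_left h₂
    linarith
  have e₁ := rename_inl_mem_gluingIdeal (B := B) (monomial_sub_mem_semigroupIdeal (k := k)
    (fun a : A => (a : ℕ)) (u := exponentL u)
    (v := exponentL v + m • Finsupp.equivFunOnFinite.symm α)
    (by rw [map_add, map_nsmul, weight_equivFunOnFinite_symm, hα, hc, smul_eq_mul, mul_comm m]))
  have e₂ := rename_inr_mem_gluingIdeal (A := A) (monomial_sub_mem_semigroupIdeal (k := k)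
    (fun b : B => (b : ℕ)) (u := exponentR v)
    (v := exponentR u + m • Finsupp.equivFunOnFinite.symm β)
    (by rw [map_add, map_nsmul, weight_equivFunOnFinite_symm, hβ, hv, smul_eq_mul, mul_comm m]))
  have hpow {σ : Type} (u w : σ →₀ ℕ) : (monomial (u + m • w) 1 : MvPolynomial σ k) =
      monomial u 1 * monomial w 1 ^ m := by simp [monomial_mul, monomial_pow]
  have e₃ := Ideal.mem_sup_right (S := gluingIdeal k A B)
    (Ideal.mem_span_singleton_self (gluingBinomial k α β))
  replace e₁ := Ideal.mem_sup_left (T := Ideal.span {gluingBinomial k α β}) e₁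
  replace e₂ := Ideal.mem_sup_left (T := Ideal.span {gluingBinomial k α β}) e₂
  rw [map_sub, hpow, map_mul, map_pow] at e₁ e₂
  nth_rw 2 [gluingBinomial_eq] at e₃
  rw [← Ideal.Quotient.eq] at e₃
  rw [← Ideal.Quotient.eq, map_mul, map_pow] at e₁ e₂
  rw [← Ideal.Quotient.eq, monomial_eq_rename_mul_rename, monomial_eq_rename_mul_rename k v,
    map_mul, map_mul, e₁, e₂, e₃]
  ring

/-- The ideal `I_C` is generated by `I_A R + I_B R` and `ρ`. -/
lemma semigroupIdeal_gluingWeight (hk : Nat.Coprime k₁ k₂) (h₂ : 0 < k₂)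
    (hα : ∑ a : A, α a * (a : ℕ) = k₂) (hβ : ∑ b : B, β b * (b : ℕ) = k₁) :
    semigroupIdeal k (gluingWeight A B k₁ k₂) =
      gluingIdeal k A B ⊔ Ideal.span {gluingBinomial k α β} := by
  apply le_antisymm
  · refine semigroupIdeal_le _ _ fun u v h => ?_
    rcases le_total (Finsupp.weight (fun a : A => (a : ℕ)) (exponentL v))
      (Finsupp.weight (fun a : A => (a : ℕ)) (exponentL u)) with hle | hle
    · exact monomial_sub_mem_of_le k hk h₂ hα hβ h hle
    · rw [← neg_sub]
      exact neg_mem (monomial_sub_mem_of_le k hk h₂ hα hβ h.symm hle)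
  · refine sup_le (sup_le (Ideal.map_le_iff_le_comap.2 fun p hp => ?_)
      (Ideal.map_le_iff_le_comap.2 fun p hp => ?_)) ?_
    · rw [semigroupIdeal, RingHom.mem_ker] at hp
      rw [Ideal.mem_comap, semigroupIdeal, RingHom.mem_ker, semigroupMap_gluingWeight_rename_inl,
        hp, map_zero]
    · rw [semigroupIdeal, RingHom.mem_ker] at hp
      rw [Ideal.mem_comap, semigroupIdeal, RingHom.mem_ker, semigroupMap_gluingWeight_rename_inr,
        hp, map_zero]
    · rw [Ideal.span_singleton_le_iff_mem, semigroupIdeal, RingHom.mem_ker, gluingBinomial_eq,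
        map_sub, semigroupMap_gluingWeight_rename_inl, semigroupMap_gluingWeight_rename_inr,
        semigroupMap_monomial, semigroupMap_monomial, weight_equivFunOnFinite_symm,
        weight_equivFunOnFinite_symm, hα, hβ]
      simp [← pow_mul, mul_comm]

/-- The maximal homogeneous ideal of `R` contains `ρ`. -/
lemma gluingBinomial_mem_span_X (hα : ∑ a : A, α a * (a : ℕ) = k₂) (h₂ : 0 < k₂)
    (hβ : ∑ b : B, β b * (b : ℕ) = k₁) (h₁ : 0 < k₁) :
    gluingBinomial k α β ∈
      Ideal.span (Set.range (X : A ⊕ B → MvPolynomial (A ⊕ B) k)) := by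
  -- Positivity of `k₂` and `k₁` forces a nonzero exponent in each monomial of `ρ`, so each is
  -- divisible by a variable.
  obtain ⟨a, -, ha⟩ := Finset.exists_ne_zero_of_sum_ne_zero (hα.trans_ne h₂.ne')
  obtain ⟨b, -, hb⟩ := Finset.exists_ne_zero_of_sum_ne_zero (hβ.trans_ne h₁.ne')
  refine sub_mem (Ideal.mem_of_dvd _ (Finset.dvd_prod_of_mem _ (Finset.mem_univ a)) ?_)
    (Ideal.mem_of_dvd _ (Finset.dvd_prod_of_mem _ (Finset.mem_univ b)) ?_)
  · exact Ideal.pow_mem_of_mem _ (Ideal.subset_span (Set.mem_range_self _)) _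
      (Nat.pos_of_ne_zero (left_ne_zero_of_mul ha))
  · exact Ideal.pow_mem_of_mem _ (Ideal.subset_span (Set.mem_range_self _)) _
      (Nat.pos_of_ne_zero (left_ne_zero_of_mul hb))

lemma isWeightedHomogeneous_rename {σ τ : Type*} {f : σ → τ}
    {w : σ → ℤ} {w' : τ → ℤ} {m : ℤ} (hw : ∀ i, w' (f i) = m * w i) {p : MvPolynomial σ k} {d : ℤ}
    (hp : IsWeightedHomogeneous w p d) : IsWeightedHomogeneous w' (rename f p) (m * d) := by
  intro u hu
  obtain ⟨v, rfl, hv⟩ := coeff_rename_ne_zero _ _ _ hu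
  rw [← hp hv]
  simp only [Finsupp.weight_apply]
  rw [Finsupp.sum_mapDomain_index (by simp) (by simp [add_mul])]
  simp only [Finsupp.sum, hw, Finset.mul_sum, nsmul_eq_mul]
  exact Finset.sum_congr rfl fun _ _ => by ring

lemma isWeightedHomogeneous_gluingBinomial
    (hα : ∑ a : A, α a * (a : ℕ) = k₂) (hβ : ∑ b : B, β b * (b : ℕ) = k₁) :
    IsWeightedHomogeneous (fun v => (gluingWeight A B k₁ k₂ v : ℤ)) (gluingBinomial k α β)
      (k₁ * k₂ : ℕ) := by
  rw [gluingBinomial_eq]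
  refine (weightedHomogeneousSubmodule k _ _).sub_mem ?_ ?_
  · have := isWeightedHomogeneous_rename k (f := (Sum.inl : A → A ⊕ B))
      (w := fun a : A => ((a : ℕ) : ℤ)) (w' := fun v => (gluingWeight A B k₁ k₂ v : ℤ)) (m := k₁)
      (by simp [gluingWeight]) (isWeightedHomogeneous_monomial _
        (Finsupp.equivFunOnFinite.symm α) 1 rfl)
    rw [weight_natCast, weight_equivFunOnFinite_symm, hα, ← Nat.cast_mul] at this
    exact this
  · have := isWeightedHomogeneous_rename k (f := (Sum.inr : B → A ⊕ B))
      (w := fun b : B => ((b : ℕ) : ℤ)) (w' := fun v => (gluingWeight A B k₁ k₂ v : ℤ)) (m := k₂)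
      (by simp [gluingWeight]) (isWeightedHomogeneous_monomial _
        (Finsupp.equivFunOnFinite.symm β) 1 rfl)
    rw [weight_natCast, weight_equivFunOnFinite_symm, hβ, ← Nat.cast_mul, mul_comm] at this
    exact this

end Gluing

end PolynomialPart

/-! ### Graded free modules through homogeneous bases -/

section GradedFree

open MvPolynomial TensorProduct

variable {k : Type u} [Field k] {σ τ : Type}

/-- A grading generated by homogeneous multiples of a basis is graded free. -/
lemma isGradedFree_closure {w : σ → ℤ} {M : Type u} [AddCommGroup M] [Module (MvPolynomial σ k) M]
    {ι : Type*} [Finite ι] (b : Module.Basis ι (MvPolynomial σ k) M) (e : ι → ℤ) (S : ℤ → Set M)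
    (h₁ : ∀ d, ∀ x ∈ S d, ∀ j, IsWeightedHomogeneous w (b.repr x j) (d - e j))
    (h₂ : ∀ (d : ℤ) (j : ι) (r : MvPolynomial σ k), IsWeightedHomogeneous w r (d - e j) →
      r • b j ∈ AddSubgroup.closure (S d)) :
    IsGradedFree (k := k) w fun d => AddSubgroup.closure (S d) := by
  have := Fintype.ofFinite ι
  let ε := Fintype.equivFin ι
  refine ⟨_, b.reindex ε, e ∘ ε.symm, fun d x => ⟨fun hx j => ?_, fun hx => ?_⟩⟩
  · simp only [Module.Basis.repr_reindex_apply, Function.comp_apply]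
    induction hx using AddSubgroup.closure_induction with
    | mem x hx => exact h₁ d x hx _
    | zero => simpa using isWeightedHomogeneous_zero k w _
    | add x y _ _ hx hy =>
      rw [map_add, Finsupp.add_apply]
      exact hx.add hy
    | neg x _ hx =>
      rw [map_neg, Finsupp.neg_apply]
      exact (weightedHomogeneousSubmodule k w _).neg_mem hx
  · rw [← b.sum_repr x]
    refine sum_mem fun j _ => h₂ d j _ ?_
    simpa using hx (ε j)

lemma basis_mem_of_forall_mem_iff {w : σ → ℤ} {M : Type u} [AddCommGroup M]
    [Module (MvPolynomial σ k) M] {ℳ : ℤ → AddSubgroup M} {ι : Type*}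
    {b : Module.Basis ι (MvPolynomial σ k) M} {e : ι → ℤ}
    (h : ∀ d x, x ∈ ℳ d ↔ ∀ j, IsWeightedHomogeneous w (b.repr x j) (d - e j)) (j : ι) :
    b j ∈ ℳ (e j) := by
  classical
  rw [h]
  intro i
  rw [Module.Basis.repr_self, Finsupp.single_apply]
  split_ifs with hij
  · subst hij
    simpa using isWeightedHomogeneous_one k w
  · exact isWeightedHomogeneous_zero k w _

lemma smul_mem_of_forall_mem_iff {w : σ → ℤ} {M : Type u} [AddCommGroup M]
    [Module (MvPolynomial σ k) M] {ℳ : ℤ → AddSubgroup M} {ι : Type*}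
    {b : Module.Basis ι (MvPolynomial σ k) M} {e : ι → ℤ}
    (h : ∀ d x, x ∈ ℳ d ↔ ∀ j, IsWeightedHomogeneous w (b.repr x j) (d - e j))
    {r : MvPolynomial σ k} {c d : ℤ} (hr : IsWeightedHomogeneous w r c) {x : M} (hx : x ∈ ℳ d) :
    r • x ∈ ℳ (c + d) := by
  rw [h] at hx ⊢
  intro j
  rw [map_smul, Finsupp.smul_apply, smul_eq_mul, add_sub_assoc]
  exact hr.mul (hx j)

lemma IsGradedFree.smul_mem {w : σ → ℤ} {M : Type u} [AddCommGroup M]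
    [Module (MvPolynomial σ k) M] {ℳ : ℤ → AddSubgroup M} (h : IsGradedFree (k := k) w ℳ)
    {r : MvPolynomial σ k} {c d : ℤ} (hr : IsWeightedHomogeneous w r c) {x : M} (hx : x ∈ ℳ d) :
    r • x ∈ ℳ (c + d) := by
  obtain ⟨n, b, e, h⟩ := h
  exact smul_mem_of_forall_mem_iff h hr hx

lemma IsGradedFree.flat {w : σ → ℤ} {M : Type u} [AddCommGroup M]
    [Module (MvPolynomial σ k) M] {ℳ : ℤ → AddSubgroup M} (h : IsGradedFree (k := k) w ℳ) :
    Module.Flat (MvPolynomial σ k) M := by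
  obtain ⟨n, b, e, h⟩ := h
  have := Module.Free.of_basis b
  infer_instance

end GradedFree

lemma exactAt_succ_iff {R : Type*} [Ring R] (F : ChainComplex (ModuleCat.{u} R) ℕ) (i : ℕ) :
    F.ExactAt (i + 1) ↔ Function.Exact (F.d (i + 2) (i + 1)).hom (F.d (i + 1) i).hom := by
  rw [HomologicalComplex.exactAt_iff' F (i + 2) (i + 1) i (by simp) (by simp),
    ShortComplex.ShortExact.moduleCat_exact_iff_function_exact]
  rfl

/-! ### Extension of scalars along a map of variables -/

section ExtendScalars

open MvPolynomial TensorProduct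

variable {k : Type u} [Field k] {σ τ : Type} (f : σ → τ)
  (F : ChainComplex (ModuleCat.{u} (MvPolynomial σ k)) ℕ)

variable (k) in
/-- The algebra structure on `k[τ]` over `k[σ]` given by an inclusion of variables. -/
@[reducible] noncomputable def renameAlgebra : Algebra (MvPolynomial σ k) (MvPolynomial τ k) :=
  (rename (R := k) f).toRingHom.toAlgebra

/-- The terms of `extendComplex f F` as tensor products. -/
noncomputable def extendEquiv (i : ℕ) :
    letI := renameAlgebra k f
    (MvPolynomial τ k ⊗[MvPolynomial σ k] F.X i) ≃ₗ[MvPolynomial τ k] (extendComplex f F).X i :=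
  letI := renameAlgebra k f
  -- Both sides are the same tensor product by definition; the equivalence only makes results on
  -- `TensorProduct` applicable.
  { toFun := id
    invFun := id
    map_add' := fun _ _ => rfl
    map_smul' := fun _ _ => rfl
    left_inv := fun _ => rfl
    right_inv := fun _ => rfl }

lemma extendComplex_d_extendEquiv (i j : ℕ) :
    letI := renameAlgebra k f
    ∀ x, ((extendComplex f F).d i j).hom (extendEquiv f F i x) =
      extendEquiv f F j ((F.d i j).hom.baseChange (MvPolynomial τ k) x) :=
  fun _ => rfl

lemma mem_extendGrading_of_tmul {w : τ → ℤ} {m : ℤ} {𝓕 : ∀ i : ℕ, ℤ → AddSubgroup (F.X i)} {i : ℕ}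
    {r : MvPolynomial τ k} {x : F.X i} {a b : ℤ} (hr : IsWeightedHomogeneous w r a)
    (hx : x ∈ 𝓕 i b) :
    letI := renameAlgebra k f
    extendEquiv f F i (r ⊗ₜ x) ∈ extendGrading f w m F 𝓕 i (a + m * b) :=
  AddSubgroup.subset_closure ⟨r, x, a, b, hr, hx, rfl, rfl⟩

variable {F}

/-- A component is generated as an additive group, so generators suffice. The form with an additive
map `φ` serves both differentials and augmentations. -/
lemma extendGrading_induction {w : τ → ℤ} {m : ℤ} {𝓕 : ∀ i : ℕ, ℤ → AddSubgroup (F.X i)} {i : ℕ}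
    {d : ℤ} {N : Type*} [AddGroup N] (φ : (extendComplex f F).X i →+ N) (S : AddSubgroup N)
    (h : letI := renameAlgebra k f
      ∀ (r : MvPolynomial τ k) (x : F.X i) (a b : ℤ), IsWeightedHomogeneous w r a → x ∈ 𝓕 i b →
        a + m * b = d → φ (extendEquiv f F i (r ⊗ₜ x)) ∈ S)
    (z) (hz : z ∈ extendGrading f w m F 𝓕 i d) : φ z ∈ S := by
  have : extendGrading f w m F 𝓕 i d ≤ S.comap φ := by
    refine (AddSubgroup.closure_le _).2 ?_
    rintro _ ⟨r, x, a, b, hr, hx, hd, rfl⟩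
    exact h r x a b hr hx hd
  exact this hz

/-- The elements `1 ⊗ b_j` form a basis with degrees `m * e j`, and the coordinates of `r ⊗ x` are
`r` times the renamed coordinates of `x`. -/
lemma isGradedFree_extendGrading {w : σ → ℤ} {w' : τ → ℤ} {m : ℤ} (hw : ∀ i, w' (f i) = m * w i)
    {𝓕 : ∀ i : ℕ, ℤ → AddSubgroup (F.X i)} {i : ℕ} (h : IsGradedFree (k := k) w (𝓕 i)) :
    IsGradedFree (k := k) w' (extendGrading f w' m F 𝓕 i) := by
  obtain ⟨n, b, e, h⟩ := h
  let := renameAlgebra k f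
  refine isGradedFree_closure ((b.baseChange (MvPolynomial τ k)).map (extendEquiv f F i))
    (fun j => m * e j) _ ?_ ?_
  · rintro d _ ⟨r, x, a, c, hr, hx, rfl, rfl⟩ j
    have : ((b.baseChange (MvPolynomial τ k)).map (extendEquiv f F i)).repr
        (extendEquiv f F i (r ⊗ₜ x)) j = r * rename f (b.repr x j) := by
      rw [Module.Basis.map_repr, LinearEquiv.trans_apply, LinearEquiv.symm_apply_apply,
        Module.Basis.baseChange_repr_tmul, Algebra.smul_def, mul_comm]
      rfl
    erw [this]
    have h' := hr.mul (isWeightedHomogeneous_rename k hw ((h c x).1 hx j))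
    convert h' using 1
    ring
  · intro d j r hr
    rw [Module.Basis.map_apply, Module.Basis.baseChange_apply, ← map_smul, smul_tmul', smul_eq_mul,
      mul_one]
    have := mem_extendGrading_of_tmul (m := m) (𝓕 := 𝓕) f F hr (basis_mem_of_forall_mem_iff h j)
    rwa [sub_add_cancel] at this

lemma extendComplex_d_mem {w' : τ → ℤ} {m : ℤ} {𝓕 : ∀ i : ℕ, ℤ → AddSubgroup (F.X i)}
    (h : ∀ (i j : ℕ) (d : ℤ), ∀ x ∈ 𝓕 i d, (F.d i j).hom x ∈ 𝓕 j d) (i j : ℕ) (d : ℤ)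
    (x) (hx : x ∈ extendGrading f w' m F 𝓕 i d) :
    ((extendComplex f F).d i j).hom x ∈ extendGrading f w' m F 𝓕 j d := by
  let := renameAlgebra k f
  refine extendGrading_induction f ((extendComplex f F).d i j).hom.toAddMonoidHom _ ?_ x hx
  rintro r y a b hr hy rfl
  exact mem_extendGrading_of_tmul f F hr (h i j b y hy)

lemma extendComplex_exactAt (hf : letI := renameAlgebra k f
      Module.Flat (MvPolynomial σ k) (MvPolynomial τ k)) {i : ℕ} (h : F.ExactAt (i + 1)) :
    (extendComplex f F).ExactAt (i + 1) := by
  let := renameAlgebra k f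
  rw [exactAt_succ_iff] at h ⊢
  exact Module.Flat.lTensor_exact (MvPolynomial τ k) h

lemma extendComplex_minimal (i : ℕ) (h : LinearMap.range (F.d (i + 1) i).hom ≤
      Ideal.span (Set.range (X : σ → MvPolynomial σ k)) • (⊤ : Submodule _ (F.X i))) :
    LinearMap.range ((extendComplex f F).d (i + 1) i).hom ≤
      Ideal.span (Set.range (X : τ → MvPolynomial τ k)) •
        (⊤ : Submodule _ ((extendComplex f F).X i)) := by
  let := renameAlgebra k f
  rintro _ ⟨z, rfl⟩
  obtain ⟨z, rfl⟩ := (extendEquiv f F (i + 1)).surjective z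
  rw [extendComplex_d_extendEquiv]
  induction z with
  | zero => simp
  | add x y hx hy =>
    rw [map_add, map_add]
    exact add_mem hx hy
  | tmul r x =>
    rw [LinearMap.baseChange_tmul]
    have hx : (F.d (i + 1) i).hom x ∈
      Ideal.span (Set.range (X : σ → MvPolynomial σ k)) • (⊤ : Submodule _ (F.X i)) := h ⟨x, rfl⟩
    generalize (F.d (i + 1) i).hom x = y at hx
    induction hx using Submodule.smul_induction_on' with
    | smul s hs y _ =>
      -- The scalar `s` crosses the tensor sign and becomes `rename f s`, again in the ideal of the
      -- variables.
      rw [← smul_tmul, Algebra.smul_def, ← smul_eq_mul, ← smul_tmul', map_smul]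
      refine Submodule.smul_mem_smul ?_ trivial
      have : Ideal.span (Set.range (X : σ → MvPolynomial σ k)) ≤
          (Ideal.span (Set.range (X : τ → MvPolynomial τ k))).comap (rename (R := k) f) := by
        rw [Ideal.span_le]
        rintro _ ⟨j, rfl⟩
        rw [SetLike.mem_coe, Ideal.mem_comap, rename_X]
        exact Ideal.subset_span (Set.mem_range_self _)
      exact this hs
    | add x _ y _ hx hy =>
      rw [tmul_add, map_add]
      exact add_mem hx hy

end ExtendScalars

/-! ### Exactness from disjointness of the two sets of variables -/

section Pushout

open MvPolynomial TensorProduct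

variable (k : Type u) [Field k] (σ τ : Type)

/-- Through `k[σ ⊔ τ] = k[τ][σ]`, the statement becomes that a polynomial ring over `k[τ]` is the
base change of the one over `k`. -/
lemma isPushout_rename :
    letI := renameAlgebra k (Sum.inl : σ → σ ⊕ τ)
    letI := renameAlgebra k (Sum.inr : τ → σ ⊕ τ)
    Algebra.IsPushout k (MvPolynomial τ k) (MvPolynomial σ k) (MvPolynomial (σ ⊕ τ) k) := by
  let := renameAlgebra k (Sum.inl : σ → σ ⊕ τ)
  let := renameAlgebra k (Sum.inr : τ → σ ⊕ τ)
  have : IsScalarTower k (MvPolynomial τ k) (MvPolynomial (σ ⊕ τ) k) :=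
    .of_algebraMap_eq fun x => ((rename (R := k) (Sum.inr : τ → σ ⊕ τ)).commutes x).symm
  have : IsScalarTower k (MvPolynomial σ k) (MvPolynomial (σ ⊕ τ) k) :=
    .of_algebraMap_eq fun x => ((rename (R := k) (Sum.inl : σ → σ ⊕ τ)).commutes x).symm
  let : Algebra (MvPolynomial σ k) (MvPolynomial σ (MvPolynomial τ k)) := algebraMvPolynomial
  refine Algebra.IsPushout.of_equiv (S' := MvPolynomial σ (MvPolynomial τ k))
    (AlgEquiv.ofRingEquiv (f := (sumAlgEquiv k σ τ).symm.toRingEquiv) fun x => ?_) ?_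
  · have := congr($(sumAlgEquiv_comp_rename_inr k σ τ) x)
    exact (AlgEquiv.symm_apply_eq _).2 this.symm
  · refine RingHom.ext fun x => ?_
    have := congr($(sumAlgEquiv_comp_rename_inl k σ τ) x)
    exact (AlgEquiv.symm_apply_eq (sumAlgEquiv k σ τ)).2 this.symm

/-- `k[σ ⊔ τ]` is the base change to `k[σ]` of `k[τ]`, which is flat over the field `k`. -/
lemma flat_rename_inl :
    letI := renameAlgebra k (Sum.inl : σ → σ ⊕ τ)
    Module.Flat (MvPolynomial σ k) (MvPolynomial (σ ⊕ τ) k) := by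
  let := renameAlgebra k (Sum.inl : σ → σ ⊕ τ)
  let := renameAlgebra k (Sum.inr : τ → σ ⊕ τ)
  have : IsScalarTower k (MvPolynomial τ k) (MvPolynomial (σ ⊕ τ) k) :=
    .of_algebraMap_eq fun x => ((rename (R := k) (Sum.inr : τ → σ ⊕ τ)).commutes x).symm
  have : IsScalarTower k (MvPolynomial σ k) (MvPolynomial (σ ⊕ τ) k) :=
    .of_algebraMap_eq fun x => ((rename (R := k) (Sum.inl : σ → σ ⊕ τ)).commutes x).symm
  exact Module.Flat.isBaseChange (R := k) (M := MvPolynomial τ k) (S := MvPolynomial σ k) _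
    (isPushout_rename k σ τ).symm.out

lemma cancelBaseChange_lTensor_baseChange {S T : Type*} [CommRing S] [CommRing T] [Algebra S T]
    {Q : Type*} [AddCommGroup Q] [Module S Q] [Module T Q] [IsScalarTower S T Q] {N N' : Type*}
    [AddCommGroup N] [Module S N] [AddCommGroup N'] [Module S N'] (g : N →ₗ[S] N')
    (x : Q ⊗[T] (T ⊗[S] N)) :
    AlgebraTensorModule.cancelBaseChange S T T Q N' ((g.baseChange T).lTensor Q x) =
      g.lTensor Q (AlgebraTensorModule.cancelBaseChange S T T Q N x) := by
  induction x with
  | zero => simp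
  | add x y hx hy => simp only [map_add, hx, hy]
  | tmul q x =>
    induction x with
    | zero => simp
    | add x y hx hy => simp only [tmul_add, map_add, hx, hy]
    | tmul t n => simp

/-- `Q ⊗_T (T ⊗_S N)` is `Q ⊗_S N`, naturally in `N`, so only flatness of `Q` over the smaller ring
`S` matters. -/
lemma exact_lTensor_baseChange_of_flat {S T : Type*} [CommRing S] [CommRing T] [Algebra S T]
    (Q : Type*) [AddCommGroup Q] [Module S Q] [Module T Q] [IsScalarTower S T Q] [Module.Flat S Q]
    {N N' N'' : Type*} [AddCommGroup N] [Module S N] [AddCommGroup N'] [Module S N']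
    [AddCommGroup N''] [Module S N''] {g : N →ₗ[S] N'} {g' : N' →ₗ[S] N''}
    (h : Function.Exact g g') :
    Function.Exact ((g.baseChange T).lTensor Q) ((g'.baseChange T).lTensor Q) := by
  have hQ := Module.Flat.lTensor_exact Q h
  intro x
  rw [← (AlgebraTensorModule.cancelBaseChange S T T Q N'').map_eq_zero_iff,
    cancelBaseChange_lTensor_baseChange, hQ]
  constructor
  · rintro ⟨y, hy⟩
    refine ⟨(AlgebraTensorModule.cancelBaseChange S T T Q N).symm y,
      (AlgebraTensorModule.cancelBaseChange S T T Q N').injective ?_⟩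
    rw [cancelBaseChange_lTensor_baseChange, LinearEquiv.apply_symm_apply, hy]
  · rintro ⟨y, rfl⟩
    exact ⟨_, (cancelBaseChange_lTensor_baseChange g y).symm⟩

/-- For a `k[σ]`-module `M`, the functor `N ↦ (k[σ ⊔ τ] ⊗ M) ⊗ (k[σ ⊔ τ] ⊗ N)` from `k[τ]`-modules
is exact: it is `N ↦ M ⊗ N`, with the tensor product taken over `k`. -/
lemma exact_lTensor_baseChange {M N N' N'' : Type*} [AddCommGroup M] [Module (MvPolynomial σ k) M]
    [AddCommGroup N] [Module (MvPolynomial τ k) N] [AddCommGroup N'] [Module (MvPolynomial τ k) N']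
    [AddCommGroup N''] [Module (MvPolynomial τ k) N''] {g : N →ₗ[MvPolynomial τ k] N'}
    {g' : N' →ₗ[MvPolynomial τ k] N''} (h : Function.Exact g g') :
    letI := renameAlgebra k (Sum.inl : σ → σ ⊕ τ)
    letI := renameAlgebra k (Sum.inr : τ → σ ⊕ τ)
    Function.Exact
      ((g.baseChange (MvPolynomial (σ ⊕ τ) k)).lTensor
        (MvPolynomial (σ ⊕ τ) k ⊗[MvPolynomial σ k] M))
      ((g'.baseChange (MvPolynomial (σ ⊕ τ) k)).lTensor
        (MvPolynomial (σ ⊕ τ) k ⊗[MvPolynomial σ k] M)) := by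
  let := renameAlgebra k (Sum.inl : σ → σ ⊕ τ)
  let := renameAlgebra k (Sum.inr : τ → σ ⊕ τ)
  have : IsScalarTower k (MvPolynomial τ k) (MvPolynomial (σ ⊕ τ) k) :=
    .of_algebraMap_eq fun x => ((rename (R := k) (Sum.inr : τ → σ ⊕ τ)).commutes x).symm
  have : IsScalarTower k (MvPolynomial σ k) (MvPolynomial (σ ⊕ τ) k) :=
    .of_algebraMap_eq fun x => ((rename (R := k) (Sum.inl : σ → σ ⊕ τ)).commutes x).symm
  have := isPushout_rename k σ τ
  let : Module k M := Module.compHom M (algebraMap k (MvPolynomial σ k))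
  have : IsScalarTower k (MvPolynomial σ k) M := .of_algebraMap_smul fun _ _ => rfl
  let Q := MvPolynomial (σ ⊕ τ) k ⊗[MvPolynomial σ k] M
  have : IsScalarTower (MvPolynomial τ k) (MvPolynomial (σ ⊕ τ) k) Q := inferInstance
  -- Over `k[τ]`, the module `Q` is `k[τ] ⊗_k M`, flat because `M` is a vector space over `k`; no
  -- flatness of `M` over `k[σ]` is needed.
  have : Module.Flat (MvPolynomial τ k) Q := Module.Flat.of_linearEquiv
    (Algebra.IsPushout.cancelBaseChange k (MvPolynomial τ k) (MvPolynomial σ k)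
      (MvPolynomial (σ ⊕ τ) k) M)
  exact exact_lTensor_baseChange_of_flat Q h

end Pushout

/-! ### The tensor product of complexes: components, exactness, augmentation -/

section TensorComplex

open TensorProduct Finset.HasAntidiagonal HomologicalComplex

variable {R : Type u} [CommRing R] (K L : ChainComplex (ModuleCat.{u} R) ℕ)

/-- The inclusion of `K_i ⊗ L_j` into `(K ⊗ L)_n`, as a linear map. -/
noncomputable def tensorIncl {i j n : ℕ} (h : i + j = n) :
    K.X i ⊗[R] L.X j →ₗ[R] (HomologicalComplex.tensorObj K L).X n :=
  (ιTensorObj K L i j n h).hom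

/-- The product of the `K_i ⊗ L_j` for `i + j = n`. -/
abbrev tensorPi (n : ℕ) : Type u := (p : antidiagonal n) → K.X p.1.1 ⊗[R] L.X p.1.2

/-- The map from `(K ⊗ L)_n` to the product of the `K_i ⊗ L_j` for `i + j = n`. -/
noncomputable def tensorToPi (n : ℕ) :
    (HomologicalComplex.tensorObj K L).X n →ₗ[R] tensorPi K L n :=
  (mapBifunctorDesc (K₁ := K) (K₂ := L) (F := curriedTensor (ModuleCat.{u} R))
    (c := ComplexShape.down ℕ) (j := n) (A := ModuleCat.of R (tensorPi K L n))
    fun i j h => ModuleCat.ofHom (LinearMap.single R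
      (fun p : antidiagonal n => K.X p.1.1 ⊗[R] L.X p.1.2) ⟨(i, j), mem_antidiagonal.2 h⟩)).hom

variable {K L}

lemma tensorToPi_tensorIncl {i j n : ℕ} (h : i + j = n) (x : K.X i ⊗[R] L.X j) :
    tensorToPi K L n (tensorIncl K L h x) =
      Pi.single (M := fun p : antidiagonal n => K.X p.1.1 ⊗[R] L.X p.1.2)
        ⟨(i, j), mem_antidiagonal.2 h⟩ x :=
  congr(($(ι_mapBifunctorDesc (K₁ := K) (K₂ := L) (F := curriedTensor (ModuleCat.{u} R))
    (c := ComplexShape.down ℕ) (j := n) (A := ModuleCat.of R (tensorPi K L n))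
    (fun i j h => ModuleCat.ofHom (LinearMap.single R
      (fun p : antidiagonal n => K.X p.1.1 ⊗[R] L.X p.1.2)
      ⟨(i, j), mem_antidiagonal.2 h⟩)) i j h)).hom x)

lemma sum_tensorIncl_tensorToPi {n : ℕ} (z : (HomologicalComplex.tensorObj K L).X n) :
    ∑ p : antidiagonal n, tensorIncl K L (mem_antidiagonal.1 p.2) (tensorToPi K L n z p) = z := by
  let φ : (HomologicalComplex.tensorObj K L).X n →ₗ[R] (HomologicalComplex.tensorObj K L).X n :=
    ∑ p : antidiagonal n, tensorIncl K L (mem_antidiagonal.1 p.2) ∘ₗ LinearMap.proj p ∘ₗ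
      tensorToPi K L n
  have hφ (z) : φ z = ∑ p : antidiagonal n, tensorIncl K L (mem_antidiagonal.1 p.2)
      (tensorToPi K L n z p) := by
    simp [φ]
  have : ModuleCat.ofHom φ = 𝟙 _ := by
    refine mapBifunctor.hom_ext fun i j h => ?_
    refine ModuleCat.hom_ext (LinearMap.ext fun x => ?_)
    change φ (tensorIncl K L h x) = tensorIncl K L h x
    rw [hφ, tensorToPi_tensorIncl, Finset.sum_eq_single ⟨(i, j), mem_antidiagonal.2 h⟩]
    · rw [Pi.single_eq_same]
    · intro p _ hp
      rw [Pi.single_eq_of_ne hp, map_zero]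
    · simp
  rw [← hφ]
  exact congr(($this).hom z)

variable (K L) in
/-- `(K ⊗ L)_n` is the product of the `K_i ⊗ L_j` for `i + j = n`. -/
noncomputable def tensorPiEquiv (n : ℕ) :
    (HomologicalComplex.tensorObj K L).X n ≃ₗ[R] tensorPi K L n :=
  LinearEquiv.ofLinearMap (tensorToPi K L n)
    (∑ p : antidiagonal n, tensorIncl K L (mem_antidiagonal.1 p.2) ∘ₗ LinearMap.proj p)
    (by
      refine LinearMap.pi_ext fun p x => ?_
      rw [LinearMap.comp_apply, LinearMap.sum_apply, Finset.sum_eq_single p]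
      · simp [tensorToPi_tensorIncl]
      · intro q _ hq
        simp [Pi.single_eq_of_ne hq]
      · simp)
    (LinearMap.ext fun z => by simpa using sum_tensorIncl_tensorToPi z)

lemma tensorPiEquiv_tensorIncl {i j n : ℕ} (h : i + j = n) (x : K.X i ⊗[R] L.X j) :
    tensorPiEquiv K L n (tensorIncl K L h x) =
      Pi.single (M := fun p : antidiagonal n => K.X p.1.1 ⊗[R] L.X p.1.2)
        ⟨(i, j), mem_antidiagonal.2 h⟩ x :=
  tensorToPi_tensorIncl h x

lemma tensorPiEquiv_symm_single {n : ℕ} (p : antidiagonal n) (x : K.X p.1.1 ⊗[R] L.X p.1.2) :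
    (tensorPiEquiv K L n).symm (Pi.single p x) = tensorIncl K L (mem_antidiagonal.1 p.2) x := by
  rw [LinearEquiv.symm_apply_eq, tensorPiEquiv_tensorIncl]

variable (K L) in
/-- The projection of `(K ⊗ L)_n` to `K_i ⊗ L_j`. -/
noncomputable def tensorProj {i j n : ℕ} (h : i + j = n) :
    (HomologicalComplex.tensorObj K L).X n →ₗ[R] K.X i ⊗[R] L.X j :=
  LinearMap.proj (φ := fun p : antidiagonal n => K.X p.1.1 ⊗[R] L.X p.1.2)
    ⟨(i, j), mem_antidiagonal.2 h⟩ ∘ₗ tensorToPi K L n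

@[simp]
lemma tensorProj_tensorIncl_self {i j n : ℕ} (h : i + j = n) (x : K.X i ⊗[R] L.X j) :
    tensorProj K L h (tensorIncl K L h x) = x := by
  rw [tensorProj, LinearMap.comp_apply, tensorToPi_tensorIncl, LinearMap.proj_apply,
    Pi.single_eq_same]

lemma tensorProj_tensorIncl_of_ne {i j i' j' n : ℕ} (h : i + j = n) (h' : i' + j' = n)
    (hi : i ≠ i') (x : K.X i ⊗[R] L.X j) :
    tensorProj K L h' (tensorIncl K L h x) = 0 := by
  rw [tensorProj, LinearMap.comp_apply, tensorToPi_tensorIncl, LinearMap.proj_apply,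
    Pi.single_eq_of_ne]
  intro h
  exact hi (by simpa using congr(($h).1.1).symm)

lemma tensorObj_ext {n : ℕ} {z z' : (HomologicalComplex.tensorObj K L).X n}
    (h : ∀ (i j : ℕ) (hij : i + j = n), tensorProj K L hij z = tensorProj K L hij z') : z = z' := by
  apply (tensorPiEquiv K L n).injective
  ext1 p
  exact h p.1.1 p.1.2 (mem_antidiagonal.1 p.2)

lemma tensorObj_induction {n : ℕ} {P : (HomologicalComplex.tensorObj K L).X n → Prop}
    (h : ∀ (i j : ℕ) (hij : i + j = n) (x : K.X i) (y : L.X j),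
      P (tensorIncl K L hij (x ⊗ₜ y)))
    (h0 : P 0) (hadd : ∀ x y, P x → P y → P (x + y)) (z) : P z := by
  rw [← sum_tensorIncl_tensorToPi z]
  refine Finset.sum_induction _ P hadd h0 fun p _ => ?_
  generalize tensorToPi K L n z p = t
  induction t with
  | zero => rwa [map_zero]
  | add x y hx hy => rw [map_add]; exact hadd _ _ hx hy
  | tmul x y => exact h _ _ _ _ _

lemma tensor_d₁_zero {n j : ℕ} :
    mapBifunctor.d₁ K L (curriedTensor (ModuleCat.{u} R)) (ComplexShape.down ℕ) 0 j n = 0 :=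
  mapBifunctor.d₁_eq_zero _ _ _ _ _ _ _ (by simp)

lemma tensor_d₂_zero {n i : ℕ} :
    mapBifunctor.d₂ K L (curriedTensor (ModuleCat.{u} R)) (ComplexShape.down ℕ) i 0 n = 0 :=
  mapBifunctor.d₂_eq_zero _ _ _ _ _ _ _ (by simp)

lemma tensor_d_tensorIncl {i j n : ℕ} (h : i + j = n + 1) (x : K.X i ⊗[R] L.X j) :
    ((HomologicalComplex.tensorObj K L).d (n + 1) n).hom (tensorIncl K L h x) =
      (mapBifunctor.d₁ K L (curriedTensor (ModuleCat.{u} R)) (ComplexShape.down ℕ) i j n).hom x +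
      (mapBifunctor.d₂ K L (curriedTensor (ModuleCat.{u} R)) (ComplexShape.down ℕ) i j n).hom x := by
  rw [← mapBifunctor.ι_D₁ K L _ _ (n + 1) n i j h, ← mapBifunctor.ι_D₂ K L _ _ (n + 1) n i j h]
  rfl

lemma tensor_d₁_succ {i j n : ℕ} (h : i + j = n) (x : K.X (i + 1) ⊗[R] L.X j) :
    (mapBifunctor.d₁ K L (curriedTensor (ModuleCat.{u} R)) (ComplexShape.down ℕ) (i + 1) j n).hom x =
      tensorIncl K L h ((K.d (i + 1) i).hom.rTensor (L.X j) x) := by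
  rw [mapBifunctor.d₁_eq K L _ _ (i₁ := i + 1) (i₁' := i) (by simp) j n h]
  have : ComplexShape.ε₁ (ComplexShape.down ℕ) (ComplexShape.down ℕ) (ComplexShape.down ℕ)
    (i + 1, j) = 1 := rfl
  rw [this, one_smul]
  rfl

lemma tensor_d₂_succ {i j n : ℕ} (h : i + j = n) (x : K.X i ⊗[R] L.X (j + 1)) :
    (mapBifunctor.d₂ K L (curriedTensor (ModuleCat.{u} R)) (ComplexShape.down ℕ) i (j + 1) n).hom x =
      (-1 : R) ^ i • tensorIncl K L h ((L.d (j + 1) j).hom.lTensor (K.X i) x) := by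
  rw [mapBifunctor.d₂_eq K L _ _ i (i₂ := j + 1) (i₂' := j) (by simp) n h]
  have : ComplexShape.ε₂ (ComplexShape.down ℕ) (ComplexShape.down ℕ) (ComplexShape.down ℕ)
    (i, j + 1) = (-1 : ℤˣ) ^ i :=
    ComplexShape.ε_down_ℕ i
  rw [this]
  -- The sign of the complex is a unit of `ℤ`, the one in the statement a scalar of `R`; they are
  -- matched by parity.
  rcases Nat.even_or_odd i with hi | hi
  · rw [hi.neg_one_pow, hi.neg_one_pow, one_smul, one_smul]
    rfl
  · rw [hi.neg_one_pow, hi.neg_one_pow, Units.neg_smul, one_smul, neg_one_smul]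
    rfl

/-- Leaving `tensorProj` of `tensorIncl` on the right avoids a case distinction: both sides vanish
unless the indices match. In this form `tensorProj_d` follows by additivity. -/
lemma tensorProj_d₁ {i j n : ℕ} (h : i + j = n) {a b : ℕ} (hab : a + b = n + 1)
    (x : K.X a ⊗[R] L.X b) :
    tensorProj K L h ((mapBifunctor.d₁ K L (curriedTensor (ModuleCat.{u} R))
      (ComplexShape.down ℕ) a b n).hom x) =
    (K.d (i + 1) i).hom.rTensor (L.X j)
      (tensorProj K L (show i + 1 + j = n + 1 by omega) (tensorIncl K L hab x)) := by
  rcases a with _ | a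
  · rw [tensor_d₁_zero, tensorProj_tensorIncl_of_ne _ _ (by omega), map_zero]
    exact map_zero _
  · rw [tensor_d₁_succ (show a + b = n by omega)]
    by_cases hai : a = i
    · subst hai
      obtain rfl : b = j := by omega
      rw [tensorProj_tensorIncl_self, tensorProj_tensorIncl_self]
    · rw [tensorProj_tensorIncl_of_ne _ _ hai, tensorProj_tensorIncl_of_ne _ _ (by omega), map_zero]

lemma tensorProj_d₂ {i j n : ℕ} (h : i + j = n) {a b : ℕ} (hab : a + b = n + 1)
    (x : K.X a ⊗[R] L.X b) :
    tensorProj K L h ((mapBifunctor.d₂ K L (curriedTensor (ModuleCat.{u} R))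
      (ComplexShape.down ℕ) a b n).hom x) =
    (-1 : R) ^ i • (L.d (j + 1) j).hom.lTensor (K.X i)
      (tensorProj K L (show i + (j + 1) = n + 1 by omega) (tensorIncl K L hab x)) := by
  rcases b with _ | b
  · rw [tensor_d₂_zero, tensorProj_tensorIncl_of_ne _ _ (by omega), map_zero, smul_zero]
    exact map_zero _
  · rw [tensor_d₂_succ (show a + b = n by omega), map_smul]
    by_cases hai : a = i
    · subst hai
      obtain rfl : b = j := by omega
      rw [tensorProj_tensorIncl_self, tensorProj_tensorIncl_self]
    · rw [tensorProj_tensorIncl_of_ne _ _ hai, tensorProj_tensorIncl_of_ne _ _ (by omega), map_zero,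
        smul_zero, smul_zero]

/-- The components of the differential of `K ⊗ L`. -/
lemma tensorProj_d {i j n : ℕ} (h : i + j = n)
    (z : (HomologicalComplex.tensorObj K L).X (n + 1)) :
    tensorProj K L h (((HomologicalComplex.tensorObj K L).d (n + 1) n).hom z) =
      (K.d (i + 1) i).hom.rTensor (L.X j)
        (tensorProj K L (show i + 1 + j = n + 1 by omega) z) +
      (-1 : R) ^ i • (L.d (j + 1) j).hom.lTensor (K.X i)
        (tensorProj K L (show i + (j + 1) = n + 1 by omega) z) := by
  induction z using tensorObj_induction with
  | h a b hab x y => rw [tensor_d_tensorIncl, map_add, tensorProj_d₁ h hab, tensorProj_d₂ h hab]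
  | h0 => simp
  | hadd x y hx hy =>
    simp only [map_add, hx, hy, smul_add]
    abel

lemma tensorProj_zero_d {n : ℕ} (z : (HomologicalComplex.tensorObj K L).X (n + 1)) :
    tensorProj K L (zero_add n) (((HomologicalComplex.tensorObj K L).d (n + 1) n).hom z) =
      (K.d 1 0).hom.rTensor (L.X n) (tensorProj K L (add_comm 1 n) z) +
      (L.d (n + 1) n).hom.lTensor (K.X 0) (tensorProj K L (zero_add (n + 1)) z) := by
  have := tensorProj_d (zero_add n) z
  rwa [pow_zero, one_smul] at this

lemma tensorProj_zero_d_add {n : ℕ} (s : K.X 0 ⊗[R] L.X (n + 1)) (r : K.X 1 ⊗[R] L.X n) :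
    tensorProj K L (zero_add n) (((HomologicalComplex.tensorObj K L).d (n + 1) n).hom
      (tensorIncl K L (zero_add (n + 1)) s + tensorIncl K L (add_comm 1 n) r)) =
    (K.d 1 0).hom.rTensor (L.X n) r + (L.d (n + 1) n).hom.lTensor (K.X 0) s := by
  rw [tensorProj_zero_d, map_add, tensorProj_tensorIncl_self,
    tensorProj_tensorIncl_of_ne _ _ zero_ne_one, zero_add, map_add, tensorProj_tensorIncl_self,
    tensorProj_tensorIncl_of_ne _ _ one_ne_zero, add_zero]

/-- If `L` consists of flat modules, `K` is a resolution of `Q`, and `Q ⊗ L` is exact in positive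
degrees, then so is `K ⊗ L`. -/
lemma tensorObj_exactAt {Q : Type*} [AddCommGroup Q] [Module R Q]
    (hL : ∀ j, Module.Flat R (L.X j)) (hK : ∀ i, K.ExactAt (i + 1)) (ε : K.X 0 →ₗ[R] Q)
    (hε : Function.Surjective ε) (hdε : Function.Exact (K.d 1 0).hom ε)
    (hQ : ∀ j, Function.Exact ((L.d (j + 2) (j + 1)).hom.lTensor Q)
      ((L.d (j + 1) j).hom.lTensor Q)) (n : ℕ) :
    (HomologicalComplex.tensorObj K L).ExactAt (n + 1) := by
  rw [exactAt_succ_iff]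
  refine fun z => ⟨fun hz => ?_, ?_⟩
  swap
  · rintro ⟨y, rfl⟩
    exact congr(($((HomologicalComplex.tensorObj K L).d_comp_d (n + 2) (n + 1) n)).hom y)
  -- The cycle `z` is cleared column by column, the column being the index of `K`: after subtracting
  -- a boundary, all components in columns below `m` vanish.
  have key : ∀ m : ℕ, ∃ y : (HomologicalComplex.tensorObj K L).X (n + 2),
      ∀ (i j : ℕ) (h : i + j = n + 1), i < m → tensorProj K L h
        (z - ((HomologicalComplex.tensorObj K L).d (n + 2) (n + 1)).hom y) = 0 := by
    intro m
    induction m with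
    | zero => exact ⟨0, by simp⟩
    | succ m ih =>
      obtain ⟨y, hy⟩ := ih
      by_cases hm : n + 1 < m
      · exact ⟨y, fun i j h _ => hy i j h (by omega)⟩
      set z' := z - ((HomologicalComplex.tensorObj K L).d (n + 2) (n + 1)).hom y with hz'
      have hdz' : ((HomologicalComplex.tensorObj K L).d (n + 1) n).hom z' = 0 := by
        rw [hz', map_sub, hz, zero_sub, neg_eq_zero]
        exact congr(($((HomologicalComplex.tensorObj K L).d_comp_d (n + 2) (n + 1) n)).hom y)
      suffices h : ∃ y' : (HomologicalComplex.tensorObj K L).X (n + 2),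
          ∀ (i j : ℕ) (h : i + j = n + 1), i < m + 1 → tensorProj K L h
            (((HomologicalComplex.tensorObj K L).d (n + 2) (n + 1)).hom y') =
              tensorProj K L h z' by
        obtain ⟨y', hy'⟩ := h
        refine ⟨y + y', fun i j h hi => ?_⟩
        rw [map_add, ← sub_sub, ← hz', map_sub, hy' i j h hi, sub_self]
      rcases m with _ | m
      -- Column `0`: as `ε` kills boundaries, `dz' = 0` makes the image of `t` in `Q ⊗ L` a cycle,
      -- hence a boundary by `hQ`. Lift it to `s`; what remains of `t` is killed by `ε`, so it comes
      -- from `r` in `K_1 ⊗ L_{n+1}`.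
      · have h0 := tensorProj_zero_d z'
        rw [hdz', map_zero] at h0
        set t := tensorProj K L (zero_add (n + 1)) z' with ht
        have hεd : ε ∘ₗ (K.d 1 0).hom = 0 := LinearMap.ext fun x => (hdε _).2 ⟨x, rfl⟩
        have hcomm {j j' : ℕ} (t : K.X 0 ⊗[R] L.X j) : (L.d j j').hom.lTensor Q (ε.rTensor _ t) =
            ε.rTensor _ ((L.d j j').hom.lTensor _ t) :=
          LinearMap.congr_fun ((LinearMap.lTensor_comp_rTensor ..).trans
            (LinearMap.rTensor_comp_lTensor ..).symm) t
        have h1 : (L.d (n + 1) n).hom.lTensor Q (ε.rTensor _ t) = 0 := by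
          have := congr(ε.rTensor (L.X n) $h0)
          rw [map_zero, map_add, ← LinearMap.comp_apply, ← LinearMap.rTensor_comp, hεd,
            LinearMap.rTensor_zero, LinearMap.zero_apply, zero_add] at this
          rw [this, hcomm]
        obtain ⟨q, hq⟩ := (hQ n _).1 h1
        obtain ⟨s, rfl⟩ := LinearMap.rTensor_surjective (L.X (n + 2)) hε q
        have h2 : ε.rTensor (L.X (n + 1)) (t - (L.d (n + 2) (n + 1)).hom.lTensor (K.X 0) s) = 0 := by
          rw [map_sub, ← hq, sub_eq_zero, hcomm]
        obtain ⟨r, hr⟩ := (rTensor_exact (L.X (n + 1)) hdε hε _).1 h2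
        refine ⟨tensorIncl K L (zero_add (n + 2)) s + tensorIncl K L (add_comm 1 (n + 1)) r,
          fun i j h hi => ?_⟩
        obtain rfl : i = 0 := by omega
        obtain rfl : j = n + 1 := by omega
        rw [tensorProj_zero_d_add, hr, sub_add_cancel]
      -- Column `m + 1`: as `z'` vanishes in column `m`, the equation `dz' = 0` read there says that
      -- the next component is a cycle of `K ⊗ L_j`. This complex is exact by flatness of `L_j`.
      · obtain ⟨j, hj⟩ : ∃ j, m + 1 + j = n + 1 := ⟨n - m, by omega⟩
        have h0 := tensorProj_d (i := m) (j := j) (by omega) z'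
        rw [hdz', map_zero, hy m (j + 1) (by omega) (by omega), map_zero, smul_zero, add_zero] at h0
        have := hL j
        have hKm := (exactAt_succ_iff K m).1 (hK m)
        obtain ⟨s, hs⟩ := (Module.Flat.rTensor_exact (L.X j) hKm _).1 h0.symm
        -- An element of column `m + 2` has its boundary in columns `m + 1` and `m + 2`, so the
        -- columns already cleared stay clear.
        refine ⟨tensorIncl K L (show m + 2 + j = n + 2 by omega) s, fun i j' h hi => ?_⟩
        by_cases him : i = m + 1
        · subst him
          obtain rfl : j' = j := by omega
          rw [tensorProj_d, tensorProj_tensorIncl_of_ne (i := m + 2) (i' := m + 1) _ _ (by omega)]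
          erw [tensorProj_tensorIncl_self]
          rw [map_zero, smul_zero, add_zero]
          exact hs
        · rw [tensorProj_d, tensorProj_tensorIncl_of_ne _ _ (by omega),
            tensorProj_tensorIncl_of_ne _ _ (by omega), hy i j' h (by omega)]
          simp
  obtain ⟨y, hy⟩ := key (n + 2)
  refine ⟨y, tensorObj_ext fun i j h => ?_⟩
  have := hy i j h (by omega)
  rw [map_sub, sub_eq_zero] at this
  exact this.symm

section Augmentation

variable {P Q : Type*} [AddCommGroup P] [Module R P] [AddCommGroup Q] [Module R Q]

/-- The augmentation of `K ⊗ L` induced by augmentations of `K` and `L`. -/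
noncomputable def tensorAugmentation (ε : K.X 0 →ₗ[R] P) (ε' : L.X 0 →ₗ[R] Q) :
    (HomologicalComplex.tensorObj K L).X 0 →ₗ[R] P ⊗[R] Q :=
  TensorProduct.map ε ε' ∘ₗ tensorProj K L (add_zero 0)

lemma tensorAugmentation_tensorIncl (ε : K.X 0 →ₗ[R] P) (ε' : L.X 0 →ₗ[R] Q) (x : K.X 0)
    (y : L.X 0) : tensorAugmentation ε ε' (tensorIncl K L (add_zero 0) (x ⊗ₜ y)) =
      ε x ⊗ₜ ε' y := by
  rw [tensorAugmentation, LinearMap.comp_apply, tensorProj_tensorIncl_self, map_tmul]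

lemma tensorAugmentation_surjective {ε : K.X 0 →ₗ[R] P} {ε' : L.X 0 →ₗ[R] Q}
    (hε : Function.Surjective ε) (hε' : Function.Surjective ε') :
    Function.Surjective (tensorAugmentation ε ε') :=
  (TensorProduct.map_surjective hε hε').comp fun x =>
    ⟨_, tensorProj_tensorIncl_self (add_zero 0) x⟩

/-- By right exactness the kernel of `ε ⊗ ε'` is the sum of the images of `K_1 ⊗ L_0` and `K_0 ⊗
L_1`, which are the two summands in degree `1`. -/
lemma tensorAugmentation_exact {ε : K.X 0 →ₗ[R] P} {ε' : L.X 0 →ₗ[R] Q}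
    (hε : Function.Surjective ε) (hε' : Function.Surjective ε')
    (hd : Function.Exact (K.d 1 0).hom ε) (hd' : Function.Exact (L.d 1 0).hom ε') :
    Function.Exact ((HomologicalComplex.tensorObj K L).d 1 0).hom (tensorAugmentation ε ε') := by
  intro z
  rw [tensorAugmentation, LinearMap.comp_apply, ← LinearMap.mem_ker,
    TensorProduct.map_ker hd hε hd' hε']
  constructor
  · intro hz
    obtain ⟨_, ⟨s, rfl⟩, _, ⟨r, rfl⟩, hsr⟩ := Submodule.mem_sup.1 hz
    refine ⟨tensorIncl K L (zero_add 1) s + tensorIncl K L (add_comm 1 0) r,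
      tensorObj_ext fun i j h => ?_⟩
    obtain rfl : i = 0 := by omega
    obtain rfl : j = 0 := by omega
    rw [tensorProj_zero_d_add, ← hsr, add_comm]
  · rintro ⟨y, rfl⟩
    rw [tensorProj_zero_d]
    exact add_mem (Submodule.mem_sup_right ⟨_, rfl⟩) (Submodule.mem_sup_left ⟨_, rfl⟩)

end Augmentation

end TensorComplex

/-! ### The grading of the tensor product -/

section TensorGrading

open TensorProduct MvPolynomial Finset.HasAntidiagonal HomologicalComplex

variable {k : Type u} [Field k] {τ : Type} {w : τ → ℤ}
  {K L : ChainComplex (ModuleCat.{u} (MvPolynomial τ k)) ℕ}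
  {𝓚 : ∀ i : ℕ, ℤ → AddSubgroup (K.X i)} {𝓛 : ∀ i : ℕ, ℤ → AddSubgroup (L.X i)}

lemma tensorIncl_mem_tensorGrading {i j n : ℕ} (h : i + j = n) {x : K.X i} {y : L.X j} {a b d : ℤ}
    (hx : x ∈ 𝓚 i a) (hy : y ∈ 𝓛 j b) (hd : a + b = d) :
    tensorIncl K L h (x ⊗ₜ y) ∈ tensorGrading K L 𝓚 𝓛 n d :=
  AddSubgroup.subset_closure ⟨i, j, h, x, y, a, b, hx, hy, hd, rfl⟩

lemma tensorGrading_induction {n : ℕ} {d : ℤ} {N : Type*} [AddGroup N]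
    (φ : (HomologicalComplex.tensorObj K L).X n →+ N) (S : AddSubgroup N)
    (h : ∀ (i j : ℕ) (hij : i + j = n) (x : K.X i) (y : L.X j) (a b : ℤ), x ∈ 𝓚 i a → y ∈ 𝓛 j b →
      a + b = d → φ (tensorIncl K L hij (x ⊗ₜ y)) ∈ S)
    (z) (hz : z ∈ tensorGrading K L 𝓚 𝓛 n d) : φ z ∈ S := by
  have : tensorGrading K L 𝓚 𝓛 n d ≤ S.comap φ := by
    refine (AddSubgroup.closure_le _).2 ?_
    rintro _ ⟨i, j, hij, x, y, a, b, hx, hy, hd, rfl⟩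
    exact h i j hij x y a b hx hy hd
  exact this hz

lemma isGradedFree_tensorGrading (hK : ∀ i, IsGradedFree (k := k) w (𝓚 i))
    (hL : ∀ i, IsGradedFree (k := k) w (𝓛 i)) (n : ℕ) :
    IsGradedFree (k := k) w (tensorGrading K L 𝓚 𝓛 n) := by
  choose nK bK eK hK using hK
  choose nL bL eL hL using hL
  refine isGradedFree_closure
    ((Pi.basis fun p : antidiagonal n => (bK p.1.1).tensorProduct (bL p.1.2)).map
      (tensorPiEquiv K L n).symm) (fun q => eK q.1.1.1 q.2.1 + eL q.1.1.2 q.2.2) _ ?_ ?_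
  · rintro d _ ⟨i, j, h, x, y, a, b, hx, hy, rfl, rfl⟩ ⟨p, s, t⟩
    change IsWeightedHomogeneous w (((bK p.1.1).tensorProduct (bL p.1.2)).repr
      (tensorPiEquiv K L n (tensorIncl K L h (x ⊗ₜ y)) p) (s, t)) _
    rw [tensorPiEquiv_tensorIncl]
    by_cases hp : p = ⟨(i, j), mem_antidiagonal.2 h⟩
    · subst hp
      rw [Pi.single_eq_same, Module.Basis.tensorProduct_repr_tmul_apply, smul_eq_mul, mul_comm]
      have := ((hK i a x).1 hx s).mul ((hL j b y).1 hy t)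
      convert this using 1
      ring
    · rw [Pi.single_eq_of_ne hp]
      simpa using isWeightedHomogeneous_zero k w _
  · rintro d ⟨p, s, t⟩ r hr
    rw [Module.Basis.map_apply, Pi.basis_apply, tensorPiEquiv_symm_single,
      Module.Basis.tensorProduct_apply, ← map_smul, smul_tmul']
    exact tensorIncl_mem_tensorGrading _
      (smul_mem_of_forall_mem_iff (hK p.1.1) hr (basis_mem_of_forall_mem_iff (hK p.1.1) s))
      (basis_mem_of_forall_mem_iff (hL p.1.2) t) (by simp only; ring)

lemma tensor_d_mem (hK : ∀ (i j : ℕ) (d : ℤ), ∀ x ∈ 𝓚 i d, (K.d i j).hom x ∈ 𝓚 j d)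
    (hL : ∀ (i j : ℕ) (d : ℤ), ∀ x ∈ 𝓛 i d, (L.d i j).hom x ∈ 𝓛 j d) (i j : ℕ) (d : ℤ)
    (z) (hz : z ∈ tensorGrading K L 𝓚 𝓛 i d) :
    ((HomologicalComplex.tensorObj K L).d i j).hom z ∈ tensorGrading K L 𝓚 𝓛 j d := by
  by_cases hij : j + 1 = i
  swap
  · rw [HomologicalComplex.shape _ _ _ (by simpa using hij)]
    exact zero_mem _
  subst hij
  refine tensorGrading_induction
    ((HomologicalComplex.tensorObj K L).d (j + 1) j).hom.toAddMonoidHom _ ?_ z hz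
  rintro s t h x y a b hx hy rfl
  change ((HomologicalComplex.tensorObj K L).d (j + 1) j).hom (tensorIncl K L h _) ∈ _
  rw [tensor_d_tensorIncl]
  refine add_mem ?_ ?_
  · rcases s with _ | s
    · rw [tensor_d₁_zero]
      exact zero_mem _
    · rw [tensor_d₁_succ (show s + t = j by omega), LinearMap.rTensor_tmul]
      exact tensorIncl_mem_tensorGrading _ (hK _ _ _ _ hx) hy rfl
  · rcases t with _ | t
    · rw [tensor_d₂_zero]
      exact zero_mem _
    · rw [tensor_d₂_succ (show s + t = j by omega), LinearMap.lTensor_tmul]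
      have := tensorIncl_mem_tensorGrading (𝓚 := 𝓚) (𝓛 := 𝓛) (show s + t = j by omega) hx
        (hL _ t _ _ hy) rfl
      -- A graded component is only an additive subgroup here, so the sign is handled through
      -- closure under negation.
      rcases Nat.even_or_odd s with hs | hs
      · rwa [hs.neg_one_pow, one_smul]
      · rw [hs.neg_one_pow, neg_one_smul]
        exact neg_mem this

end TensorGrading

/-! ### Minimality of the tensor product -/

section TensorMinimal

open TensorProduct HomologicalComplex

variable {R : Type u} [CommRing R] {K L : ChainComplex (ModuleCat.{u} R) ℕ}

lemma tmul_mem_smul_top_left {M N : Type*} [AddCommGroup M] [Module R M] [AddCommGroup N]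
    [Module R N] {I : Ideal R} {x : M} (hx : x ∈ I • (⊤ : Submodule R M)) (y : N) :
    x ⊗ₜ[R] y ∈ I • (⊤ : Submodule R (M ⊗[R] N)) := by
  have : I • (⊤ : Submodule R M) ≤ (I • (⊤ : Submodule R (M ⊗[R] N))).comap
      ((TensorProduct.mk R M N).flip y) := by
    rw [← Submodule.map_le_iff_le_comap, Submodule.map_smul'']
    exact Submodule.smul_mono le_rfl le_top
  exact this hx

lemma tmul_mem_smul_top_right {M N : Type*} [AddCommGroup M] [Module R M] [AddCommGroup N]
    [Module R N] {I : Ideal R} (x : M) {y : N} (hy : y ∈ I • (⊤ : Submodule R N)) :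
    x ⊗ₜ[R] y ∈ I • (⊤ : Submodule R (M ⊗[R] N)) := by
  have : I • (⊤ : Submodule R N) ≤ (I • (⊤ : Submodule R (M ⊗[R] N))).comap
      (TensorProduct.mk R M N x) := by
    rw [← Submodule.map_le_iff_le_comap, Submodule.map_smul'']
    exact Submodule.smul_mono le_rfl le_top
  exact this hy

lemma LinearMap.map_mem_smul_top {M N : Type*} [AddCommGroup M] [Module R M] [AddCommGroup N]
    [Module R N] {I : Ideal R} (f : M →ₗ[R] N) {x : M} (hx : x ∈ I • (⊤ : Submodule R M)) :
    f x ∈ I • (⊤ : Submodule R N) := by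
  have := Submodule.mem_map_of_mem (f := f) hx
  rw [Submodule.map_smul''] at this
  exact Submodule.smul_mono le_rfl le_top this

lemma tensor_minimal {I : Ideal R}
    (hK : ∀ i, LinearMap.range (K.d (i + 1) i).hom ≤ I • (⊤ : Submodule R (K.X i)))
    (hL : ∀ i, LinearMap.range (L.d (i + 1) i).hom ≤ I • (⊤ : Submodule R (L.X i))) (n : ℕ) :
    LinearMap.range ((HomologicalComplex.tensorObj K L).d (n + 1) n).hom ≤
      I • (⊤ : Submodule R ((HomologicalComplex.tensorObj K L).X n)) := by
  rintro _ ⟨z, rfl⟩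
  induction z using tensorObj_induction with
  | h0 => rw [map_zero]; exact zero_mem _
  | hadd x y hx hy => rw [map_add]; exact add_mem hx hy
  | h s t h x y =>
    rw [tensor_d_tensorIncl]
    refine add_mem ?_ ?_
    · rcases s with _ | s
      · rw [tensor_d₁_zero]
        exact zero_mem _
      · rw [tensor_d₁_succ (show s + t = n by omega), LinearMap.rTensor_tmul]
        exact LinearMap.map_mem_smul_top _ (tmul_mem_smul_top_left (hK _ ⟨x, rfl⟩) y)
    · rcases t with _ | t
      · rw [tensor_d₂_zero]
        exact zero_mem _
      · rw [tensor_d₂_succ (show s + t = n by omega), LinearMap.lTensor_tmul]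
        exact Submodule.smul_mem _ _
          (LinearMap.map_mem_smul_top _ (tmul_mem_smul_top_right x (hL _ ⟨y, rfl⟩)))

end TensorMinimal

/-! ### The mapping cone, and the case of multiplication by `ρ` -/

section Cone

open HomologicalComplex

variable {R : Type u} [CommRing R] {K L : ChainComplex (ModuleCat.{u} R) ℕ} (φ : K ⟶ L)

/-- The inclusion of `K_n` into degree `n + 1` of the mapping cone of `K ⟶ L`. -/
noncomputable def coneInl (n : ℕ) : K.X n →ₗ[R] (homotopyCofiber φ).X (n + 1) :=
  (homotopyCofiber.inlX φ n (n + 1) rfl).hom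

/-- The inclusion of `L_n` into degree `n` of the mapping cone of `K ⟶ L`. -/
noncomputable def coneInr (n : ℕ) : L.X n →ₗ[R] (homotopyCofiber φ).X n :=
  (homotopyCofiber.inrX φ n).hom

/-- The projection of degree `n + 1` of the mapping cone of `K ⟶ L` to `K_n`. -/
noncomputable def coneFst (n : ℕ) : (homotopyCofiber φ).X (n + 1) →ₗ[R] K.X n :=
  (homotopyCofiber.fstX φ (n + 1) n rfl).hom

/-- The projection of degree `n` of the mapping cone of `K ⟶ L` to `L_n`. -/
noncomputable def coneSnd (n : ℕ) : (homotopyCofiber φ).X n →ₗ[R] L.X n :=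
  (homotopyCofiber.sndX φ n).hom

lemma coneFst_coneInl (n : ℕ) (x : K.X n) : coneFst φ n (coneInl φ n x) = x :=
  congr(($(homotopyCofiber.inlX_fstX φ n (n + 1) rfl)).hom x)

lemma coneSnd_coneInl (n : ℕ) (x : K.X n) : coneSnd φ (n + 1) (coneInl φ n x) = 0 :=
  congr(($(homotopyCofiber.inlX_sndX φ n (n + 1) rfl)).hom x)

lemma coneFst_coneInr (n : ℕ) (y : L.X (n + 1)) : coneFst φ n (coneInr φ (n + 1) y) = 0 :=
  congr(($(homotopyCofiber.inrX_fstX φ (n + 1) n rfl)).hom y)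

lemma coneSnd_coneInr (n : ℕ) (y : L.X n) : coneSnd φ n (coneInr φ n y) = y :=
  congr(($(homotopyCofiber.inrX_sndX φ n)).hom y)

lemma coneInl_add_coneInr (n : ℕ) (z : (homotopyCofiber φ).X (n + 1)) :
    coneInl φ n (coneFst φ n z) + coneInr φ (n + 1) (coneSnd φ (n + 1) z) = z := by
  have hn : (ComplexShape.down ℕ).Rel (n + 1) n := rfl
  have : homotopyCofiber.fstX φ (n + 1) n hn ≫ homotopyCofiber.inlX φ n (n + 1) hn +
      homotopyCofiber.sndX φ (n + 1) ≫ homotopyCofiber.inrX φ (n + 1) = 𝟙 _ := by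
    apply homotopyCofiber.ext_to_X φ (n + 1) n hn
    · rw [Preadditive.add_comp, Category.assoc, Category.assoc, homotopyCofiber.inlX_fstX,
        homotopyCofiber.inrX_fstX, Category.comp_id, Limits.comp_zero, add_zero, Category.id_comp]
    · rw [Preadditive.add_comp, Category.assoc, Category.assoc, homotopyCofiber.inlX_sndX,
        homotopyCofiber.inrX_sndX, Category.comp_id, Limits.comp_zero, zero_add, Category.id_comp]
  exact congr(($this).hom z)

lemma coneInr_coneSnd_zero (z : (homotopyCofiber φ).X 0) :
    coneInr φ 0 (coneSnd φ 0 z) = z :=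
  congr(($(homotopyCofiber.sndX_inrX φ 0 (by simp))).hom z)

variable {φ} in
lemma cone_ext {n : ℕ} {z z' : (homotopyCofiber φ).X (n + 1)} (h₁ : coneFst φ n z = coneFst φ n z')
    (h₂ : coneSnd φ (n + 1) z = coneSnd φ (n + 1) z') : z = z' := by
  rw [← coneInl_add_coneInr φ n z, h₁, h₂, coneInl_add_coneInr]

lemma coneFst_d (n : ℕ) (z : (homotopyCofiber φ).X (n + 2)) :
    coneFst φ n (((homotopyCofiber φ).d (n + 2) (n + 1)).hom z) =
      -(K.d (n + 1) n).hom (coneFst φ (n + 1) z) :=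
  congr(($(homotopyCofiber.d_fstX φ (n + 2) (n + 1) n rfl rfl)).hom z)

lemma coneSnd_d (n : ℕ) (z : (homotopyCofiber φ).X (n + 1)) :
    coneSnd φ n (((homotopyCofiber φ).d (n + 1) n).hom z) =
      (φ.f n).hom (coneFst φ n z) + (L.d (n + 1) n).hom (coneSnd φ (n + 1) z) :=
  congr(($(homotopyCofiber.d_sndX φ (n + 1) n rfl)).hom z)

lemma cone_d_succ (n : ℕ) (z : (homotopyCofiber φ).X (n + 2)) :
    ((homotopyCofiber φ).d (n + 2) (n + 1)).hom z =
      -coneInl φ n ((K.d (n + 1) n).hom (coneFst φ (n + 1) z)) +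
        coneInr φ (n + 1) ((φ.f (n + 1)).hom (coneFst φ (n + 1) z) +
          (L.d (n + 2) (n + 1)).hom (coneSnd φ (n + 2) z)) := by
  apply cone_ext
  · rw [coneFst_d, map_add, map_neg, coneFst_coneInl, coneFst_coneInr, add_zero]
  · rw [coneSnd_d, map_add, map_neg, coneSnd_coneInl, coneSnd_coneInr, neg_zero, zero_add]

lemma cone_d_zero (z : (homotopyCofiber φ).X 1) :
    ((homotopyCofiber φ).d 1 0).hom z =
      coneInr φ 0 ((φ.f 0).hom (coneFst φ 0 z) + (L.d 1 0).hom (coneSnd φ 1 z)) := by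
  rw [← coneSnd_d, coneInr_coneSnd_zero]

/-- Degree `n + 1` of the mapping cone of `K ⟶ L` is `K_n × L_{n + 1}`. -/
noncomputable def coneSuccEquiv (n : ℕ) :
    (homotopyCofiber φ).X (n + 1) ≃ₗ[R] K.X n × L.X (n + 1) where
  toLinearMap := (coneFst φ n).prod (coneSnd φ (n + 1))
  invFun := (coneInl φ n).coprod (coneInr φ (n + 1))
  left_inv z := coneInl_add_coneInr φ n z
  right_inv := by
    rintro ⟨x, y⟩
    change (coneFst φ n (coneInl φ n x + coneInr φ (n + 1) y),
      coneSnd φ (n + 1) (coneInl φ n x + coneInr φ (n + 1) y)) = (x, y)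
    rw [map_add, map_add, coneFst_coneInl, coneFst_coneInr, coneSnd_coneInl, coneSnd_coneInr,
      add_zero, zero_add]

lemma coneSuccEquiv_symm_apply (n : ℕ) (x : K.X n) (y : L.X (n + 1)) :
    (coneSuccEquiv φ n).symm (x, y) = coneInl φ n x + coneInr φ (n + 1) y :=
  rfl

/-- Degree `0` of the mapping cone of `K ⟶ L` is `L_0`. -/
noncomputable def coneZeroEquiv : (homotopyCofiber φ).X 0 ≃ₗ[R] L.X 0 where
  toLinearMap := coneSnd φ 0
  invFun := coneInr φ 0
  left_inv z := coneInr_coneSnd_zero φ z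
  right_inv y := coneSnd_coneInr φ 0 y

lemma cone_minimal {I : Ideal R}
    (hK : ∀ i, LinearMap.range (K.d (i + 1) i).hom ≤ I • (⊤ : Submodule R (K.X i)))
    (hL : ∀ i, LinearMap.range (L.d (i + 1) i).hom ≤ I • (⊤ : Submodule R (L.X i)))
    (hφ : ∀ i, LinearMap.range (φ.f i).hom ≤ I • (⊤ : Submodule R (L.X i))) (n : ℕ) :
    LinearMap.range ((homotopyCofiber φ).d (n + 1) n).hom ≤
      I • (⊤ : Submodule R ((homotopyCofiber φ).X n)) := by
  rintro _ ⟨z, rfl⟩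
  rcases n with _ | n
  · erw [cone_d_zero]
    exact LinearMap.map_mem_smul_top _ (add_mem (hφ _ ⟨_, rfl⟩) (hL _ ⟨_, rfl⟩))
  · rw [cone_d_succ]
    exact add_mem (neg_mem (LinearMap.map_mem_smul_top _ (hK _ ⟨_, rfl⟩)))
      (LinearMap.map_mem_smul_top _ (add_mem (hφ _ ⟨_, rfl⟩) (hL _ ⟨_, rfl⟩)))

section Multiplication

variable {G : ChainComplex (ModuleCat.{u} R) ℕ} {M : Type*} [AddCommGroup M] [Module R M]
  {ρ : R} {ε : G.X 0 →ₗ[R] M}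

/-- The mapping cone of multiplication by a nonzerodivisor on a resolution is exact in positive
degrees. -/
lemma cone_smul_exactAt (hG : ∀ i, G.ExactAt (i + 1)) (hdε : Function.Exact (G.d 1 0).hom ε)
    (hρ : ∀ m : M, ρ • m = 0 → m = 0) (n : ℕ) :
    (homotopyCofiber (ρ • 𝟙 G)).ExactAt (n + 1) := by
  rw [exactAt_succ_iff]
  refine fun z => ⟨fun hz => ?_, ?_⟩
  swap
  · rintro ⟨y, rfl⟩
    exact congr(($((homotopyCofiber (ρ • 𝟙 G)).d_comp_d (n + 2) (n + 1) n)).hom y)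
  have hφ {i : ℕ} (x : G.X i) : ((ρ • 𝟙 G : G ⟶ G).f i).hom x = ρ • x := rfl
  -- Write `z = (a, b)`. The second component of `dz = 0` reads `ρ a + d b = 0`; for `n > 0` the
  -- first gives `d a = 0`.
  have h₂ : ρ • coneFst (ρ • 𝟙 G) n z + (G.d (n + 1) n).hom (coneSnd (ρ • 𝟙 G) (n + 1) z) = 0 := by
    rw [← hφ, ← coneSnd_d, hz, map_zero]
  -- For `n > 0` this is exactness of `G`. For `n = 0`, `ρ ε(a) = -ε(d b) = 0`, so `ε(a) = 0`: the
  -- only use of `ρ` being a nonzerodivisor on `M`.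
  obtain ⟨x, hx⟩ : ∃ x, (G.d (n + 1) n).hom x = coneFst (ρ • 𝟙 G) n z := by
    rcases n with _ | n
    · refine (hdε _).1 (hρ _ ?_)
      rw [← map_smul]
      refine (hdε _).2 ⟨-coneSnd (ρ • 𝟙 G) 1 z, ?_⟩
      rw [map_neg]
      exact (eq_neg_of_add_eq_zero_left h₂).symm
    · refine ((exactAt_succ_iff G n).1 (hG n) _).1 ?_
      have := coneFst_d _ n z
      rwa [hz, map_zero, eq_comm, neg_eq_zero] at this
  have h₃ : (G.d (n + 1) n).hom (ρ • x + coneSnd (ρ • 𝟙 G) (n + 1) z) = 0 := by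
    rw [map_add, map_smul, hx, h₂]
  obtain ⟨y, hy⟩ := ((exactAt_succ_iff G n).1 (hG n) _).1 h₃
  -- With `d y = ρ x + b`, the boundary of `(-x, y)` is `(d x, -ρ x + d y) = (a, b)`.
  refine ⟨coneInr _ (n + 2) y - coneInl _ (n + 1) x, cone_ext ?_ ?_⟩
  · rw [coneFst_d, map_sub, coneFst_coneInl, coneFst_coneInr, zero_sub, map_neg, neg_neg, hx]
  · rw [coneSnd_d, map_sub (coneFst _ _), map_sub (coneSnd _ _), coneFst_coneInl,
      coneFst_coneInr, coneSnd_coneInl, coneSnd_coneInr, hφ, zero_sub, sub_zero, hy, smul_neg,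
      neg_add_cancel_left]

/-- The image of the differential is `ρ G_0 + d G_1`, the preimage under `ε` of `ρ M`, and `hπ` says
that `ρ M` is the kernel of `π`. -/
lemma cone_smul_exact_augmentation {N : Type*} [AddCommGroup N] [Module R N]
    (hε : Function.Surjective ε) (hdε : Function.Exact (G.d 1 0).hom ε) (π : M →ₗ[R] N)
    (hπ : ∀ m, π m = 0 ↔ ∃ m', ρ • m' = m) :
    Function.Exact ((homotopyCofiber (ρ • 𝟙 G)).d 1 0).hom
      (π ∘ₗ ε ∘ₗ coneSnd (ρ • 𝟙 G) 0) := by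
  have hφ {i : ℕ} (x : G.X i) : ((ρ • 𝟙 G : G ⟶ G).f i).hom x = ρ • x := rfl
  intro z
  rw [LinearMap.comp_apply, LinearMap.comp_apply, hπ]
  constructor
  · rintro ⟨m, hm⟩
    obtain ⟨x, rfl⟩ := hε m
    rw [eq_comm, ← sub_eq_zero, ← map_smul, ← map_sub] at hm
    obtain ⟨y, hy⟩ := (hdε _).1 hm
    refine ⟨coneInl _ 0 x + coneInr _ 1 y, ?_⟩
    rw [cone_d_zero, map_add (coneFst _ _), map_add (coneSnd _ _), coneFst_coneInl,
      coneFst_coneInr, coneSnd_coneInl, coneSnd_coneInr, add_zero, zero_add, hy, hφ,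
      add_sub_cancel, coneInr_coneSnd_zero]
  · rintro ⟨y, rfl⟩
    refine ⟨ε (coneFst _ 0 y), ?_⟩
    rw [cone_d_zero, coneSnd_coneInr, map_add, hφ, map_smul, (hdε _).2 ⟨_, rfl⟩, add_zero]

end Multiplication

end Cone

/-! ### The grading of the mapping cone -/

section ConeGrading

open HomologicalComplex MvPolynomial

variable {k : Type u} [Field k] {τ : Type} {w : τ → ℤ}
  {K L : ChainComplex (ModuleCat.{u} (MvPolynomial τ k)) ℕ} {φ : K ⟶ L} {e : ℤ}
  {𝓚 : ∀ i : ℕ, ℤ → AddSubgroup (K.X i)} {𝓛 : ∀ i : ℕ, ℤ → AddSubgroup (L.X i)}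

lemma coneInl_mem_coneGrading {n : ℕ} {d : ℤ} {x : K.X n} (hx : x ∈ 𝓚 n (d - e)) :
    coneInl φ n x ∈ coneGrading φ e 𝓚 𝓛 (n + 1) d :=
  AddSubgroup.subset_closure (Or.inl ⟨n, rfl, x, hx, rfl⟩)

lemma coneInr_mem_coneGrading {n : ℕ} {d : ℤ} {y : L.X n} (hy : y ∈ 𝓛 n d) :
    coneInr φ n y ∈ coneGrading φ e 𝓚 𝓛 n d :=
  AddSubgroup.subset_closure (Or.inr ⟨y, hy, rfl⟩)

lemma coneGrading_succ_induction {n : ℕ} {d : ℤ} {N : Type*} [AddGroup N]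
    (ψ : (homotopyCofiber φ).X (n + 1) →+ N) (S : AddSubgroup N)
    (h₁ : ∀ x ∈ 𝓚 n (d - e), ψ (coneInl φ n x) ∈ S)
    (h₂ : ∀ y ∈ 𝓛 (n + 1) d, ψ (coneInr φ (n + 1) y) ∈ S)
    (z) (hz : z ∈ coneGrading φ e 𝓚 𝓛 (n + 1) d) : ψ z ∈ S := by
  have : coneGrading φ e 𝓚 𝓛 (n + 1) d ≤ S.comap ψ := by
    refine (AddSubgroup.closure_le _).2 ?_
    rintro _ (⟨i, hi, x, hx, rfl⟩ | ⟨y, hy, rfl⟩)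
    · obtain rfl : i = n := by simpa using hi
      exact h₁ x hx
    · exact h₂ y hy
  exact this hz

lemma coneSnd_mem_of_mem_coneGrading_zero {d : ℤ} {z : (homotopyCofiber φ).X 0}
    (hz : z ∈ coneGrading φ e 𝓚 𝓛 0 d) : coneSnd φ 0 z ∈ 𝓛 0 d := by
  have : coneGrading φ e 𝓚 𝓛 0 d ≤ (𝓛 0 d).comap (coneSnd φ 0).toAddMonoidHom := by
    refine (AddSubgroup.closure_le _).2 ?_
    rintro z (⟨i, hi, -⟩ | ⟨y, hy, hz⟩)
    · exact absurd hi (Nat.succ_ne_zero i)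
    · change coneSnd φ 0 z ∈ 𝓛 0 d
      rw [show z = coneInr φ 0 y from hz, coneSnd_coneInr]
      exact hy
  exact this hz

/-- Basis elements from `K` are shifted to degree `c j + e`, those from `L` keep theirs. Degree `0`
is separate because only `L_0` occurs there. -/
lemma isGradedFree_coneGrading (hK : ∀ i, IsGradedFree (k := k) w (𝓚 i))
    (hL : ∀ i, IsGradedFree (k := k) w (𝓛 i)) (n : ℕ) :
    IsGradedFree (k := k) w (coneGrading φ e 𝓚 𝓛 n) := by
  rcases n with _ | n
  · obtain ⟨m, b, c, h⟩ := hL 0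
    refine ⟨m, b.map (coneZeroEquiv φ).symm, c, fun d z => ?_⟩
    change _ ↔ ∀ j, IsWeightedHomogeneous w (b.repr (coneSnd φ 0 z) j) _
    rw [← h]
    refine ⟨coneSnd_mem_of_mem_coneGrading_zero, fun hz => ?_⟩
    rw [← coneInr_coneSnd_zero φ z]
    exact coneInr_mem_coneGrading hz
  · obtain ⟨m, b, c, h⟩ := hK n
    obtain ⟨m', b', c', h'⟩ := hL (n + 1)
    refine isGradedFree_closure ((b.prod b').map (coneSuccEquiv φ n).symm)
      (Sum.elim (fun j => c j + e) c') _ ?_ ?_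
    · rintro d _ (⟨i, hi, x, hx, rfl⟩ | ⟨y, hy, rfl⟩) j
      · obtain rfl : i = n := by simpa using hi
        change IsWeightedHomogeneous w ((b.prod b').repr (coneFst φ i (coneInl φ i x),
          coneSnd φ (i + 1) (coneInl φ i x)) j) _
        rw [coneFst_coneInl, coneSnd_coneInl]
        rcases j with j | j
        · rw [Module.Basis.prod_repr_inl]
          have := (h _ x).1 hx j
          convert this using 1
          simp only [Sum.elim_inl]
          ring
        · rw [Module.Basis.prod_repr_inr]
          simpa using isWeightedHomogeneous_zero k w _
      · change IsWeightedHomogeneous w ((b.prod b').repr (coneFst φ n (coneInr φ (n + 1) y),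
          coneSnd φ (n + 1) (coneInr φ (n + 1) y)) j) _
        rw [coneFst_coneInr, coneSnd_coneInr]
        rcases j with j | j
        · rw [Module.Basis.prod_repr_inl]
          simpa using isWeightedHomogeneous_zero k w _
        · rw [Module.Basis.prod_repr_inr]
          exact (h' _ y).1 hy j
    · rintro d (j | j) r hr
      · have hb : ((b.prod b').map (coneSuccEquiv φ n).symm) (Sum.inl j) = coneInl φ n (b j) := by
          rw [Module.Basis.map_apply, Module.Basis.prod_apply, Sum.elim_inl, Function.comp_apply,
            LinearMap.inl_apply, coneSuccEquiv_symm_apply, map_zero, add_zero]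
        rw [hb, ← map_smul]
        refine coneInl_mem_coneGrading ?_
        have := smul_mem_of_forall_mem_iff h hr (basis_mem_of_forall_mem_iff h j)
        convert this using 2
        simp only [Sum.elim_inl]
        ring
      · have hb : ((b.prod b').map (coneSuccEquiv φ n).symm) (Sum.inr j) =
            coneInr φ (n + 1) (b' j) := by
          rw [Module.Basis.map_apply, Module.Basis.prod_apply, Sum.elim_inr, Function.comp_apply,
            LinearMap.inr_apply, coneSuccEquiv_symm_apply, map_zero, zero_add]
        rw [hb, ← map_smul]
        refine coneInr_mem_coneGrading ?_
        have := smul_mem_of_forall_mem_iff h' hr (basis_mem_of_forall_mem_iff h' j)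
        convert this using 2
        simp

lemma cone_d_mem (hK : ∀ (i j : ℕ) (d : ℤ), ∀ x ∈ 𝓚 i d, (K.d i j).hom x ∈ 𝓚 j d)
    (hL : ∀ (i j : ℕ) (d : ℤ), ∀ x ∈ 𝓛 i d, (L.d i j).hom x ∈ 𝓛 j d)
    (hφ : ∀ (i : ℕ) (d : ℤ), ∀ x ∈ 𝓚 i (d - e), (φ.f i).hom x ∈ 𝓛 i d) (i j : ℕ) (d : ℤ)
    (z) (hz : z ∈ coneGrading φ e 𝓚 𝓛 i d) :
    ((homotopyCofiber φ).d i j).hom z ∈ coneGrading φ e 𝓚 𝓛 j d := by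
  by_cases hij : j + 1 = i
  swap
  · rw [HomologicalComplex.shape _ _ _ (by simpa using hij)]
    exact zero_mem _
  subst hij
  refine coneGrading_succ_induction ((homotopyCofiber φ).d (j + 1) j).hom.toAddMonoidHom _
    (fun x hx => ?_) (fun y hy => ?_) z hz
  · change ((homotopyCofiber φ).d (j + 1) j).hom (coneInl φ j x) ∈ _
    rcases j with _ | j
    · erw [cone_d_zero]
      rw [coneFst_coneInl, coneSnd_coneInl, map_zero, add_zero]
      exact coneInr_mem_coneGrading (hφ _ _ _ hx)
    · rw [cone_d_succ, coneFst_coneInl, coneSnd_coneInl, map_zero, add_zero]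
      exact add_mem (neg_mem (coneInl_mem_coneGrading (hK _ _ _ _ hx)))
        (coneInr_mem_coneGrading (hφ _ _ _ hx))
  · change ((homotopyCofiber φ).d (j + 1) j).hom (coneInr φ (j + 1) y) ∈ _
    rcases j with _ | j
    · erw [cone_d_zero]
      rw [coneFst_coneInr, coneSnd_coneInr, map_zero, zero_add]
      exact coneInr_mem_coneGrading (hL _ _ _ _ hy)
    · rw [cone_d_succ, coneFst_coneInr, coneSnd_coneInr, map_zero, map_zero, map_zero, neg_zero,
        zero_add, zero_add]
      exact coneInr_mem_coneGrading (hL _ _ _ _ hy)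

end ConeGrading

/-! ### Tensor products of quotient rings -/

section QuotientTensor

open TensorProduct

variable {R : Type*} [CommRing R] (I I' : Ideal R)

/-- The isomorphism `R / I ⊗ R / I' ≃ R / (I + I')`. -/
noncomputable def quotientTensorQuotientSupEquiv :
    ((R ⧸ I) ⊗[R] (R ⧸ I')) ≃ₗ[R] R ⧸ (I ⊔ I') :=
  LinearEquiv.ofLinearMap
    (LinearMap.mul' R (R ⧸ (I ⊔ I')) ∘ₗ
      TensorProduct.map (Submodule.factor (le_sup_left : I ≤ I ⊔ I'))
        (Submodule.factor (le_sup_right : I' ≤ I ⊔ I')))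
    (Submodule.liftQ (I ⊔ I')
      (LinearMap.toSpanSingleton R ((R ⧸ I) ⊗[R] (R ⧸ I')) (1 ⊗ₜ 1)) (by
        refine sup_le (fun r hr => ?_) (fun r hr => ?_)
        · rw [LinearMap.mem_ker, LinearMap.toSpanSingleton_apply, smul_tmul', Algebra.smul_def,
            mul_one, Ideal.Quotient.algebraMap_eq, Ideal.Quotient.eq_zero_iff_mem.2 hr, zero_tmul]
        · rw [LinearMap.mem_ker, LinearMap.toSpanSingleton_apply, ← tmul_smul, Algebra.smul_def,
            mul_one, Ideal.Quotient.algebraMap_eq, Ideal.Quotient.eq_zero_iff_mem.2 hr, tmul_zero]))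
    (by
      refine LinearMap.ext fun x => ?_
      obtain ⟨r, rfl⟩ := Ideal.Quotient.mk_surjective x
      change (LinearMap.mul' R (R ⧸ (I ⊔ I')) ∘ₗ
        TensorProduct.map (Submodule.factor (le_sup_left : I ≤ I ⊔ I'))
          (Submodule.factor (le_sup_right : I' ≤ I ⊔ I')))
          (r • ((1 : R ⧸ I) ⊗ₜ[R] (1 : R ⧸ I'))) = Ideal.Quotient.mk _ r
      rw [map_smul]
      change r • ((1 : R ⧸ (I ⊔ I')) * 1) = _
      rw [mul_one, Algebra.smul_def, mul_one, Ideal.Quotient.algebraMap_eq])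
    (by
      refine TensorProduct.ext' fun x y => ?_
      obtain ⟨r, rfl⟩ := Ideal.Quotient.mk_surjective x
      obtain ⟨s, rfl⟩ := Ideal.Quotient.mk_surjective y
      change (r * s) • ((1 : R ⧸ I) ⊗ₜ[R] (1 : R ⧸ I')) = _
      rw [mul_smul, ← tmul_smul, smul_tmul', Algebra.smul_def, mul_one, Algebra.smul_def, mul_one]
      rfl)

lemma quotientTensorQuotientSupEquiv_mk_tmul_mk (r s : R) :
    quotientTensorQuotientSupEquiv I I' (Ideal.Quotient.mk I r ⊗ₜ Ideal.Quotient.mk I' s) =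
      Ideal.Quotient.mk (I ⊔ I') (r * s) :=
  rfl

end QuotientTensor

/-! ### Augmentations after extension of scalars -/

section ExtendAugmentation

open TensorProduct MvPolynomial

variable {k : Type u} [Field k] {σ τ : Type} (c : σ → ℕ)

variable (k) in
/-- The surjection `k[σ] → k[t ^ c_i : i ∈ σ]` as a linear map. -/
noncomputable def semigroupLinearMap : MvPolynomial σ k →ₗ[MvPolynomial σ k] semigroupRing k c :=
  LinearMap.toSpanSingleton _ _ 1

lemma coe_semigroupLinearMap (p : MvPolynomial σ k) :
    (semigroupLinearMap k c p : Polynomial k) = semigroupMap k c p := by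
  change semigroupMap k c p * 1 = _
  rw [mul_one]

lemma semigroupLinearMap_surjective : Function.Surjective (semigroupLinearMap k c) := by
  rintro ⟨_, p, rfl⟩
  exact ⟨p, Subtype.ext (coe_semigroupLinearMap c p)⟩

lemma ker_semigroupLinearMap : LinearMap.ker (semigroupLinearMap k c) = semigroupIdeal k c := by
  ext p
  rw [LinearMap.mem_ker, semigroupIdeal, RingHom.mem_ker, ← coe_semigroupLinearMap,
    ZeroMemClass.coe_eq_zero]

/-- The isomorphism of the semigroup ring with the quotient by the defining ideal. -/
noncomputable def semigroupRingEquiv :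
    semigroupRing k c ≃ₗ[MvPolynomial σ k] MvPolynomial σ k ⧸ semigroupIdeal k c :=
  ((Submodule.quotEquivOfEq _ _ (ker_semigroupLinearMap c).symm).trans
    ((semigroupLinearMap k c).quotKerEquivOfSurjective (semigroupLinearMap_surjective c))).symm

lemma semigroupRingEquiv_apply {x : semigroupRing k c} {p : MvPolynomial σ k}
    (h : semigroupMap k c p = x) : semigroupRingEquiv c x = Ideal.Quotient.mk _ p := by
  rw [semigroupRingEquiv, LinearEquiv.symm_apply_eq]
  refine Subtype.ext (h.symm.trans ?_)
  exact (coe_semigroupLinearMap c p).symm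

/-- Extension of scalars of an augmentation to a semigroup ring. -/
lemma exists_extend_augmentation (f : σ → τ) (F : ChainComplex (ModuleCat.{u} (MvPolynomial σ k)) ℕ)
    (ε : F.X 0 →ₗ[MvPolynomial σ k] semigroupRing k c) (hε : Function.Surjective ε)
    (hdε : Function.Exact (F.d 1 0).hom ε) :
    ∃ η : (extendComplex f F).X 0 →ₗ[MvPolynomial τ k]
        MvPolynomial τ k ⧸ (semigroupIdeal k c).map (rename (R := k) f),
      Function.Surjective η ∧ Function.Exact ((extendComplex f F).d 1 0).hom η ∧
        letI := renameAlgebra k f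
        ∀ (r : MvPolynomial τ k) (x : F.X 0) (p : MvPolynomial σ k), semigroupMap k c p = ε x →
          η (extendEquiv f F 0 (r ⊗ₜ x)) = Ideal.Quotient.mk _ (r * rename f p) := by
  let := renameAlgebra k f
  -- The semigroup ring is replaced by a quotient of `k[σ]`, since the base change of a quotient is
  -- the quotient by the extended ideal.
  let g : F.X 0 →ₗ[MvPolynomial σ k] MvPolynomial σ k ⧸ semigroupIdeal k c :=
    (semigroupRingEquiv c).toLinearMap ∘ₗ ε
  have hg : Function.Surjective g := (semigroupRingEquiv c).surjective.comp hε
  have hdg : Function.Exact (F.d 1 0).hom g := fun x =>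
    ((semigroupRingEquiv c).map_eq_zero_iff).trans (hdε x)
  let e := (Algebra.TensorProduct.quotIdealMapEquivTensorQuot (MvPolynomial τ k)
    (semigroupIdeal k c)).toLinearEquiv.symm
  refine ⟨e.toLinearMap ∘ₗ g.baseChange (MvPolynomial τ k) ∘ₗ (extendEquiv f F 0).symm.toLinearMap,
    ?_, ?_, ?_⟩
  · exact e.surjective.comp ((LinearMap.lTensor_surjective _ hg).comp
      (extendEquiv f F 0).symm.surjective)
  · intro z
    exact (e.map_eq_zero_iff).trans (lTensor_exact (MvPolynomial τ k) hdg hg z)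
  · intro r x p hp
    change e (r ⊗ₜ semigroupRingEquiv c (ε x)) = _
    rw [semigroupRingEquiv_apply c hp]
    refine (Algebra.TensorProduct.quotIdealMapEquivTensorQuot_symm_tmul (MvPolynomial τ k)
      (semigroupIdeal k c) r p).trans ?_
    rw [Algebra.smul_def, mul_comm]
    rfl

/-- For homogeneous `r` and `x`, a homogeneous lift `p` of `ε x` makes `r * rename f p` a
homogeneous representative of the value at `r ⊗ x`. -/
lemma extend_augmentation_mem {f : σ → τ} {w : τ → ℤ} {m : ℤ} (hw : ∀ i, w (f i) = m * c i)
    {F : ChainComplex (ModuleCat.{u} (MvPolynomial σ k)) ℕ} {𝓕 : ∀ i : ℕ, ℤ → AddSubgroup (F.X i)}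
    {ε : F.X 0 →ₗ[MvPolynomial σ k] semigroupRing k c}
    (hε : ∀ d, ∀ x ∈ 𝓕 0 d, ε x ∈ semigroupRing.grading k c d)
    {J : Ideal (MvPolynomial τ k)} {η : (extendComplex f F).X 0 →ₗ[MvPolynomial τ k] _ ⧸ J}
    (hη : letI := renameAlgebra k f
      ∀ (r : MvPolynomial τ k) (x : F.X 0) (p : MvPolynomial σ k), semigroupMap k c p = ε x →
        η (extendEquiv f F 0 (r ⊗ₜ x)) = Ideal.Quotient.mk J (r * rename f p)) {d : ℤ}
    {z} (hz : z ∈ extendGrading f w m F 𝓕 0 d) : η z ∈ quotientGrading w J d := by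
  refine extendGrading_induction f η.toAddMonoidHom (quotientGrading w J d) ?_ z hz
  rintro r x a b hr hx rfl
  obtain ⟨p, hp, hpx⟩ := exists_isWeightedHomogeneous_semigroupMap_eq c (hε b x hx)
  exact ⟨r * rename f p, hr.mul (isWeightedHomogeneous_rename k hw hp), (hη r x p hpx).symm⟩

end ExtendAugmentation

/-! ### Assembling the two resolutions -/

section Main

open TensorProduct MvPolynomial HomologicalComplex

lemma isMinimalGradedFreeResolution_gluingTensor {k : Type u} [Field k] {A B : Finset ℕ}
    (k₁ k₂ : ℕ) {FA : ChainComplex (ModuleCat.{u} (MvPolynomial A k)) ℕ}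
    {𝓐 : ∀ i : ℕ, ℤ → AddSubgroup (FA.X i)}
    (hFA : IsMinimalGradedFreeResolution (fun a : A => (a : ℤ)) FA 𝓐
      (semigroupRing.grading k (fun a : A => (a : ℕ))))
    {FB : ChainComplex (ModuleCat.{u} (MvPolynomial B k)) ℕ}
    {𝓑 : ∀ i : ℕ, ℤ → AddSubgroup (FB.X i)}
    (hFB : IsMinimalGradedFreeResolution (fun b : B => (b : ℤ)) FB 𝓑
      (semigroupRing.grading k (fun b : B => (b : ℕ)))) :
    IsMinimalGradedFreeResolution (fun v => (gluingWeight A B k₁ k₂ v : ℤ))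
      (gluingTensor FA FB) (gluingTensorGrading k₁ k₂ FA 𝓐 FB 𝓑)
      (quotientGrading (fun v => (gluingWeight A B k₁ k₂ v : ℤ)) (gluingIdeal k A B)) := by
  have hwA (a : A) : (gluingWeight A B k₁ k₂ (Sum.inl a) : ℤ) = k₁ * a := by simp [gluingWeight]
  have hwB (b : B) : (gluingWeight A B k₁ k₂ (Sum.inr b) : ℤ) = k₂ * b := by simp [gluingWeight]
  have hA (i) := isGradedFree_extendGrading (w' := fun v => (gluingWeight A B k₁ k₂ v : ℤ))
    Sum.inl hwA (hFA.free i)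
  have hB (i) := isGradedFree_extendGrading (w' := fun v => (gluingWeight A B k₁ k₂ v : ℤ))
    Sum.inr hwB (hFB.free i)
  obtain ⟨εA, hεA, hsA, hdA⟩ := hFA.augmentation
  obtain ⟨εB, hεB, hsB, hdB⟩ := hFB.augmentation
  refine ⟨isGradedFree_tensorGrading hA hB,
    tensor_d_mem (extendComplex_d_mem _ hFA.d_mem) (extendComplex_d_mem _ hFB.d_mem), ?_, ?_,
    tensor_minimal (fun i => extendComplex_minimal _ i (hFA.minimal i))
      (fun i => extendComplex_minimal _ i (hFB.minimal i))⟩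
  · rintro (_ | n) hn
    · exact absurd hn (lt_irrefl 0)
    let := renameAlgebra k (Sum.inl : A → A ⊕ B)
    let := renameAlgebra k (Sum.inr : B → A ⊕ B)
    -- Here `Q` is `R ⊗ k[A]`, resolved by the extension of `F_A` because `R` is flat over `R_A`.
    refine tensorObj_exactAt (fun j => (hB j).flat)
      (fun i => extendComplex_exactAt _ (flat_rename_inl k A B) (hFA.exact _ i.succ_pos))
      (εA.baseChange (MvPolynomial (A ⊕ B) k) ∘ₗ (extendEquiv Sum.inl FA 0).symm.toLinearMap)
      ?_ ?_ (fun j => ?_) n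
    · exact (LinearMap.lTensor_surjective _ hsA).comp (extendEquiv Sum.inl FA 0).symm.surjective
    · exact lTensor_exact (MvPolynomial (A ⊕ B) k) hdA hsA
    · exact exact_lTensor_baseChange k A B ((exactAt_succ_iff FB j).1 (hFB.exact _ j.succ_pos))
  · obtain ⟨ηA, hηA, hdηA, hA⟩ := exists_extend_augmentation (τ := A ⊕ B) _ Sum.inl FA εA hsA hdA
    obtain ⟨ηB, hηB, hdηB, hB⟩ := exists_extend_augmentation (τ := A ⊕ B) _ Sum.inr FB εB hsB hdB
    let e := quotientTensorQuotientSupEquiv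
      ((semigroupIdeal k (fun a : A => (a : ℕ))).map (rename (R := k) (Sum.inl : A → A ⊕ B)))
      ((semigroupIdeal k (fun b : B => (b : ℕ))).map (rename (R := k) (Sum.inr : B → A ⊕ B)))
    refine ⟨e.toLinearMap ∘ₗ tensorAugmentation ηA ηB, ?_, ?_, ?_⟩
    · intro d z hz
      refine tensorGrading_induction (e.toLinearMap ∘ₗ tensorAugmentation ηA ηB).toAddMonoidHom
        (quotientGrading (fun v => (gluingWeight A B k₁ k₂ v : ℤ)) (gluingIdeal k A B) d) ?_ z hz
      intro i j hij x y a b hx hy hab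
      obtain rfl : i = 0 := by omega
      obtain rfl : j = 0 := by omega
      obtain ⟨p, hp, hpx⟩ := extend_augmentation_mem
        (w := fun v => (gluingWeight A B k₁ k₂ v : ℤ)) _ hwA hεA hA hx
      obtain ⟨q, hq, hqy⟩ := extend_augmentation_mem
        (w := fun v => (gluingWeight A B k₁ k₂ v : ℤ)) _ hwB hεB hB hy
      refine ⟨p * q, hab ▸ hp.mul hq, ?_⟩
      change _ = e (tensorAugmentation ηA ηB (tensorIncl _ _ (add_zero 0) (x ⊗ₜ y)))
      rw [tensorAugmentation_tensorIncl, ← hpx, ← hqy]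
      exact (quotientTensorQuotientSupEquiv_mk_tmul_mk _ _ p q).symm
    · exact e.surjective.comp (tensorAugmentation_surjective hηA hηB)
    · intro z
      exact (e.map_eq_zero_iff).trans (tensorAugmentation_exact hηA hηB hdηA hdηB z)

section Cone

variable {k : Type u} [Field k] {A B : Finset ℕ} {k₁ k₂ : ℕ} {α : A → ℕ} {β : B → ℕ}

variable (k) in
/-- The projection `R / (I_A R + I_B R) → k[C]`. -/
noncomputable def gluingProjection
    (h : gluingIdeal k A B ≤ semigroupIdeal k (gluingWeight A B k₁ k₂)) :
    MvPolynomial (A ⊕ B) k ⧸ gluingIdeal k A B →ₗ[MvPolynomial (A ⊕ B) k]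
      semigroupRing k (gluingWeight A B k₁ k₂) :=
  Submodule.liftQ _ (semigroupLinearMap k (gluingWeight A B k₁ k₂))
    (h.trans (ker_semigroupLinearMap _).ge)

lemma coe_gluingProjection_mk
    (h : gluingIdeal k A B ≤ semigroupIdeal k (gluingWeight A B k₁ k₂))
    (p : MvPolynomial (A ⊕ B) k) :
    (gluingProjection k h (Ideal.Quotient.mk _ p) : Polynomial k) =
      semigroupMap k (gluingWeight A B k₁ k₂) p :=
  coe_semigroupLinearMap _ p

/-- As `I_C` is generated by `I_A R + I_B R` and `ρ`, the kernel consists of the multiples of `ρ`;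
this is hypothesis `hπ` of `cone_smul_exact_augmentation`. -/
lemma gluingProjection_eq_zero_iff
    (h : gluingIdeal k A B ≤ semigroupIdeal k (gluingWeight A B k₁ k₂))
    (hI : semigroupIdeal k (gluingWeight A B k₁ k₂) =
      gluingIdeal k A B ⊔ Ideal.span {gluingBinomial k α β})
    (m : MvPolynomial (A ⊕ B) k ⧸ gluingIdeal k A B) :
    gluingProjection k h m = 0 ↔ ∃ m', gluingBinomial k α β • m' = m := by
  obtain ⟨p, rfl⟩ := Ideal.Quotient.mk_surjective m
  have : gluingProjection k h (Ideal.Quotient.mk _ p) = 0 ↔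
      p ∈ semigroupIdeal k (gluingWeight A B k₁ k₂) := by
    rw [← ZeroMemClass.coe_eq_zero, coe_gluingProjection_mk, semigroupIdeal, RingHom.mem_ker]
  rw [this, hI]
  constructor
  · intro hp
    obtain ⟨j, hj, s, hs, rfl⟩ := Submodule.mem_sup.1 hp
    obtain ⟨r, rfl⟩ := Ideal.mem_span_singleton'.1 hs
    refine ⟨Ideal.Quotient.mk _ r, ?_⟩
    rw [map_add, Ideal.Quotient.eq_zero_iff_mem.2 hj, zero_add, mul_comm, map_mul]
    rfl
  · rintro ⟨m, hm⟩
    obtain ⟨r, rfl⟩ := Ideal.Quotient.mk_surjective m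
    have hm' : Ideal.Quotient.mk (gluingIdeal k A B) (gluingBinomial k α β * r) =
      Ideal.Quotient.mk _ p := hm
    rw [← sub_sub_cancel (gluingBinomial k α β * r) p]
    exact sub_mem (Ideal.mem_sup_right (Ideal.mul_mem_right _ _ (Ideal.mem_span_singleton_self _)))
      (Ideal.mem_sup_left (Ideal.Quotient.eq.1 hm'))

lemma gluingBinomial_smul_eq_zero (hα : ∑ a : A, α a * (a : ℕ) = k₂) (h₂ : 0 < k₂)
    (m : MvPolynomial (A ⊕ B) k ⧸ gluingIdeal k A B) (hm : gluingBinomial k α β • m = 0) :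
    m = 0 := by
  obtain ⟨p, rfl⟩ := Ideal.Quotient.mk_surjective m
  have hm' : Ideal.Quotient.mk (gluingIdeal k A B) (gluingBinomial k α β * p) = 0 := hm
  rw [Ideal.Quotient.eq_zero_iff_mem] at hm' ⊢
  exact ((gluingIdeal_isPrime k).mem_or_mem hm').resolve_left
    (gluingBinomial_notMem_gluingIdeal k hα h₂)

/-- The mapping cone of multiplication by `ρ` on a minimal graded free resolution of
`R / (I_A R + I_B R)` is one of `k[C]`. -/
lemma isMinimalGradedFreeResolution_cone (hk : Nat.Coprime k₁ k₂) (h₁ : 0 < k₁) (h₂ : 0 < k₂)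
    (hα : ∑ a : A, α a * (a : ℕ) = k₂) (hβ : ∑ b : B, β b * (b : ℕ) = k₁)
    {G : ChainComplex (ModuleCat.{u} (MvPolynomial (A ⊕ B) k)) ℕ}
    {𝓖 : ∀ i : ℕ, ℤ → AddSubgroup (G.X i)}
    (hG : IsMinimalGradedFreeResolution (fun v => (gluingWeight A B k₁ k₂ v : ℤ)) G 𝓖
      (quotientGrading (fun v => (gluingWeight A B k₁ k₂ v : ℤ)) (gluingIdeal k A B))) :
    IsMinimalGradedFreeResolution (fun v => (gluingWeight A B k₁ k₂ v : ℤ))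
      (homotopyCofiber (gluingBinomial k α β • 𝟙 G))
      (coneGrading (gluingBinomial k α β • 𝟙 G) (k₁ * k₂ : ℕ) 𝓖 𝓖)
      (semigroupRing.grading k (gluingWeight A B k₁ k₂)) := by
  obtain ⟨ε, hε, hs, hd⟩ := hG.augmentation
  have hI := semigroupIdeal_gluingWeight k hk h₂ hα hβ
  have hle : gluingIdeal k A B ≤ semigroupIdeal k (gluingWeight A B k₁ k₂) := hI ▸ le_sup_left
  refine ⟨isGradedFree_coneGrading hG.free hG.free, cone_d_mem hG.d_mem hG.d_mem ?_, ?_, ?_,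
    cone_minimal _ hG.minimal hG.minimal ?_⟩
  -- Multiplication by `ρ` raises degrees by `k₁ * k₂`, which the shift in the cone compensates.
  · intro i d x hx
    have := (hG.free i).smul_mem (isWeightedHomogeneous_gluingBinomial k hα hβ) hx
    rwa [add_sub_cancel] at this
  · rintro (_ | n) hn
    · exact absurd hn (lt_irrefl 0)
    · exact cone_smul_exactAt (fun i => hG.exact _ i.succ_pos) hd
        (gluingBinomial_smul_eq_zero hα h₂) n
  · refine ⟨gluingProjection k hle ∘ₗ ε ∘ₗ coneSnd _ 0, fun d z hz => ?_, ?_,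
      cone_smul_exact_augmentation hs hd _ (gluingProjection_eq_zero_iff hle hI)⟩
    -- Membership in `quotientGrading` supplies a homogeneous representative `p`, whose image in
    -- `k[t]` is concentrated in degree `d`.
    · obtain ⟨p, hp, hpz⟩ := hε d _ (coneSnd_mem_of_mem_coneGrading_zero hz)
      intro n hn
      refine semigroupMap_coeff_of_isWeightedHomogeneous _ hp n ?_
      rw [← coe_gluingProjection_mk hle]
      rw [LinearMap.comp_apply, LinearMap.comp_apply, ← hpz] at hn
      exact hn
    · have hc : Function.Surjective (coneSnd (gluingBinomial k α β • 𝟙 G) 0) := fun x =>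
        ⟨coneInr _ 0 x, coneSnd_coneInr _ 0 x⟩
      refine Function.Surjective.comp (g := gluingProjection k hle) ?_ (hs.comp hc)
      intro x
      obtain ⟨p, rfl⟩ := semigroupLinearMap_surjective _ x
      exact ⟨Ideal.Quotient.mk _ p, rfl⟩
  · rintro i _ ⟨x, rfl⟩
    exact Submodule.smul_mem_smul (gluingBinomial_mem_span_X k hα h₂ hβ h₁) Submodule.mem_top

lemma gluingIdeal_colon (hα : ∑ a : A, α a * (a : ℕ) = k₂) (h₂ : 0 < k₂) :
    (gluingIdeal k A B).colon {gluingBinomial k α β} = gluingIdeal k A B := by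
  ext p
  rw [Submodule.mem_colon_singleton, smul_eq_mul]
  exact ⟨fun h => ((gluingIdeal_isPrime k).mem_or_mem h).resolve_right
    (gluingBinomial_notMem_gluingIdeal k hα h₂), fun h => Ideal.mul_mem_right _ _ h⟩

end Cone

end Main

theorem theorem3p1 {k : Type u} [Field k] (C A B : Finset ℕ) (k₁ k₂ : ℕ)
    (hC : IsGluing C A B k₁ k₂)
    -- minimal graded free resolutions of `k[A]` and `k[B]`
    (FA : ChainComplex (ModuleCat.{u} (MvPolynomial A k)) ℕ)
    (𝓐 : ∀ i : ℕ, ℤ → AddSubgroup (FA.X i))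
    (hFA : IsMinimalGradedFreeResolution (fun a : A => (a : ℤ)) FA 𝓐
      (semigroupRing.grading k (fun a : A => (a : ℕ))))
    (FB : ChainComplex (ModuleCat.{u} (MvPolynomial B k)) ℕ)
    (𝓑 : ∀ i : ℕ, ℤ → AddSubgroup (FB.X i))
    (hFB : IsMinimalGradedFreeResolution (fun b : B => (b : ℤ)) FB 𝓑
      (semigroupRing.grading k (fun b : B => (b : ℕ))))
    -- `k₂ = ∑ α_a a` and `k₁ = ∑ β_b b`
    (α : A → ℕ) (hα : ∑ a : A, α a * (a : ℕ) = k₂)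
    (β : B → ℕ) (hβ : ∑ b : B, β b * (b : ℕ) = k₁) :
    -- `F_A ⊗ F_B` resolves `R / (I_A R + I_B R)`
    IsMinimalGradedFreeResolution (fun v => (gluingWeight A B k₁ k₂ v : ℤ))
      (gluingTensor FA FB) (gluingTensorGrading k₁ k₂ FA 𝓐 FB 𝓑)
      (quotientGrading (fun v => (gluingWeight A B k₁ k₂ v : ℤ)) (gluingIdeal k A B)) ∧
    -- the mapping cone of multiplication by `ρ` on `F_A ⊗ F_B` resolves `k[C]`
    IsMinimalGradedFreeResolution (fun v => (gluingWeight A B k₁ k₂ v : ℤ))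
      (HomologicalComplex.homotopyCofiber (gluingBinomial k α β • 𝟙 (gluingTensor FA FB)))
      (coneGrading (gluingBinomial k α β • 𝟙 (gluingTensor FA FB)) (k₁ * k₂ : ℕ)
        (gluingTensorGrading k₁ k₂ FA 𝓐 FB 𝓑) (gluingTensorGrading k₁ k₂ FA 𝓐 FB 𝓑))
      (semigroupRing.grading k (gluingWeight A B k₁ k₂)) ∧
    -- `(I_A R + I_B R : ρ) = I_A R + I_B R`
    (gluingIdeal k A B).colon {gluingBinomial k α β} = gluingIdeal k A B := by
  have hT := isMinimalGradedFreeResolution_gluingTensor k₁ k₂ hFA hFB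
  exact ⟨hT, isMinimalGradedFreeResolution_cone hC.coprime hC.pos₁ hC.pos₂ hα hβ hT,
    gluingIdeal_colon hα hC.pos₂⟩
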